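/- Let $n,k\ge 0$ be integers and let $\mathcal W=(w_1,\dots,w_n)$ be a nondecreasing sequence of weights $w_i\in\mathbb N$. A cell of the permutohedron $P(n)$ is an ordered partition $f=(B_1\mid\cdots\mid B_r)$ of $\{1,\dots,n\}$ into nonempty blocks; its dimension is $n-r$. The weight of a block is the sum of the weights of its elements, and $P(n,\mathcal W,k)$ is the subcomplex of $P(n)$ consisting of the cells all of whose blocks have weight at most $k$. Its cellular chain complex $C_*(P(n,\mathcal W,k))$ is the complex of free abelian groups on these cells, with differential determined by $$\partial (B)=\sum_{B=a\sqcup b,\ a,b\neq\emptyset}(-1)^{|a|}\,\mathrm{sgn}(B\mapsto ab)\,(a\mid b),\qquad \partial(f\mid g)=\partial f\mid g+(-1)^{\dim f} f\mid\partial g,$$ where $\mathrm{sgn}(B\mapsto ab)$ is the sign of the permutation that takes the increasing arrangement of $B$ to the increasing arrangement of $a$ followed by that of $b$, and $\mid$ is the bilinear concatenation product. Walking through a cell from left to right, call a block a follower if the block just before it is a singleton that is not itself a follower and whose element is smaller than every element of the block; that singleton is its leader. For a cell $e$ whose blocks are all of the types (a), (b) below, write $e$ as the concatenation of its leader-follower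 pairs $(L\mid B)$ and of its remaining blocks, which are singletons, and let $z(e)$ be the concatenation product, in the same order, of the boundaries $\partial(L\cup B)$ for the pairs and of the $0$-cells given by the remaining singletons. Then for every $j\ge 0$ the homology group $H_j(P(n,\mathcal W,k))$ of this complex is free abelian. Each such $z(e)$ is a cycle in $C_*(P(n,\mathcal W,k))$, and a $\mathbb Z$-basis of $H_j(P(n,\mathcal W,k))$ is given by the classes of the $z(e)$, where $e$ ranges over all $j$-dimensional cells of $P(n,\mathcal W,k)$ each of whose blocks is either (a) a singleton which is not a follower, or (b) a follower such that its weight and that of its leader add up to at least $k+1$. -/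

import Mathlib

open CategoryTheory

namespace WeightedPermutohedron

/-- Symbols: finite sequences of blocks `(B₁ | B₂ | ⋯ | B_r)` of labels from `Fin n`. -/
abbrev Symbol (n : ℕ) : Type := List (Finset (Fin n))

/-- The symbols labelling the cells of the permutohedron `P(n)`: ordered partitions of the set of
all labels into nonempty blocks. The cell with symbol `f` has dimension `n - f.length`. -/
def IsOrderedPartition {n : ℕ} (f : Symbol n) : Prop :=
  (∀ B ∈ f, B.Nonempty) ∧ f.Pairwise Disjoint ∧ ∀ i : Fin n, ∃ B ∈ f, i ∈ B

/-- The weight of a block is the total weight of its elements. -/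
def blockWeight {n : ℕ} (W : Fin n → ℕ) (B : Finset (Fin n)) : ℕ := ∑ i ∈ B, W i

/-- The cells of `P(n, W, k)`: the cells of `P(n)` all of whose blocks have weight at most `k`. -/
def IsCell {n : ℕ} (W : Fin n → ℕ) (k : ℕ) (f : Symbol n) : Prop :=
  IsOrderedPartition f ∧ ∀ B ∈ f, blockWeight W B ≤ k

/-- The set of `d`-dimensional cells of `P(n, W, k)`, i.e. those with `n - d` blocks. -/
def cells {n : ℕ} (W : Fin n → ℕ) (k d : ℕ) : Set (Symbol n) :=
  {f | IsCell W k f ∧ f.length + d = n}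

/-- Formal integral linear combinations of symbols. -/
abbrev Chain (n : ℕ) : Type := Symbol n →₀ ℤ

/-- The concatenation product `x | y`, the bilinear extension of concatenation of symbols. -/
noncomputable def concat {n : ℕ} : Chain n →ₗ[ℤ] Chain n →ₗ[ℤ] Chain n :=
  Finsupp.lsum ℤ fun f => LinearMap.toSpanSingleton ℤ (Chain n →ₗ[ℤ] Chain n)
    (Finsupp.lmapDomain ℤ ℤ fun g => f ++ g)

/-- The sign of the permutation taking the increasing arrangement of `a ∪ b` to the increasing
arrangement of `a` followed by the increasing arrangement of `b`, computed by counting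
inversions. -/
def shuffleSign {n : ℕ} (a b : Finset (Fin n)) : ℤ :=
  (-1) ^ ((a ×ˢ b).filter fun p => p.2 < p.1).card

/-- The boundary of a one-block symbol `(B)`: the sum over all ways to split `B` into two nonempty
blocks `a | b` of `(-1)^|a| · sgn(B ↦ ab) · (a | b)`. -/
noncomputable def blockBoundary {n : ℕ} (B : Finset (Fin n)) : Chain n :=
  ∑ a ∈ B.ssubsets.filter Finset.Nonempty,
    Finsupp.single [a, B \ a] ((-1) ^ a.card * shuffleSign a (B \ a))

/-- The boundary of a symbol, by the Leibniz rule
`∂(B | f) = ∂B | f + (-1)^(dim B) B | ∂f`, where `dim B = |B| - 1`. -/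
noncomputable def symbolBoundary {n : ℕ} : Symbol n → Chain n
  | [] => 0
  | B :: f => concat (blockBoundary B) (Finsupp.single f 1) +
      (-1 : ℤ) ^ (B.card - 1) • concat (Finsupp.single [B] 1) (symbolBoundary f)

/-- The boundary operator, the linear extension of `symbolBoundary`. -/
noncomputable def boundary {n : ℕ} : Chain n →ₗ[ℤ] Chain n :=
  Finsupp.linearCombination ℤ symbolBoundary

/-- The group of cellular `d`-chains of `P(n, W, k)`. -/
noncomputable def chains {n : ℕ} (W : Fin n → ℕ) (k d : ℕ) : Submodule ℤ (Chain n) :=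
  Finsupp.supported ℤ ℤ (cells W k d)

section lemmas

variable {n : ℕ}

theorem concat_single (f g : Symbol n) (a b : ℤ) :
    concat (Finsupp.single f a) (Finsupp.single g b) = Finsupp.single (f ++ g) (a * b) := by
  simp [concat, Finsupp.mapDomain_single]

theorem concat_assoc (x y z : Chain n) :
    concat (concat x y) z = concat x (concat y z) := by
  induction x using Finsupp.induction_linear with
  | zero => simp
  | add x x' hx hx' => simp [hx, hx']
  | single f a =>
    induction y using Finsupp.induction_linear with
    | zero => simp
    | add y y' hy hy' => simp [hy, hy']
    | single g b =>
      induction z using Finsupp.induction_linear with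
      | zero => simp
      | add z z' hz hz' => rw [map_add, hz, hz', map_add, map_add]
      | single h c => simp only [concat_single, mul_assoc, List.append_assoc]

theorem boundary_single (f : Symbol n) (a : ℤ) :
    boundary (Finsupp.single f a) = a • symbolBoundary f := by
  simp [boundary]

theorem symbolBoundary_block (B : Finset (Fin n)) : symbolBoundary [B] = blockBoundary B := by
  have h : ∀ x : Chain n, concat x (Finsupp.single [] 1) = x := by
    intro x
    induction x using Finsupp.induction_linear with
    | zero => simp
    | add x x' hx hx' => simp [hx, hx']
    | single f a => simp [concat_single]
  simp [symbolBoundary, h]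

theorem boundary_cons (B : Finset (Fin n)) (x : Chain n) :
    boundary (concat (Finsupp.single [B] 1) x) = concat (blockBoundary B) x +
      (-1 : ℤ) ^ (B.card - 1) • concat (Finsupp.single [B] 1) (boundary x) := by
  induction x using Finsupp.induction_linear with
  | zero => simp
  | add x x' hx hx' => simp only [map_add, hx, hx', smul_add]; abel
  | single f a =>
    have hs : (Finsupp.single f a : Chain n) = a • Finsupp.single f 1 := by simp
    rw [hs]
    simp only [map_smul, concat_single, boundary_single, one_smul, mul_one]
    simp only [List.cons_append, List.nil_append, symbolBoundary, smul_add]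
    rw [smul_comm a]

theorem boundary_pair (a b : Finset (Fin n)) (c : ℤ) (x : Chain n) :
    boundary (concat (Finsupp.single [a, b] c) x) =
      c • concat (concat (blockBoundary a) (Finsupp.single [b] 1)) x +
      (c * (-1) ^ (a.card - 1)) •
        concat (concat (Finsupp.single [a] 1) (blockBoundary b)) x +
      (c * (-1) ^ (a.card - 1) * (-1) ^ (b.card - 1)) •
        concat (Finsupp.single [a, b] 1) (boundary x) := by
  have hs : (Finsupp.single [a, b] c : Chain n) =
      c • concat (Finsupp.single [a] 1) (Finsupp.single [b] 1) := by
    simp [concat_single]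
  have hs' : (Finsupp.single [a, b] 1 : Chain n) =
      concat (Finsupp.single [a] 1) (Finsupp.single [b] 1) := by
    simp [concat_single]
  rw [hs, hs']
  simp only [map_smul, LinearMap.smul_apply, concat_assoc, boundary_cons, map_add, smul_add,
    smul_smul, mul_assoc]
  abel

theorem shuffleSign_union_left {a b c : Finset (Fin n)} (h : Disjoint a b) :
    shuffleSign (a ∪ b) c = shuffleSign a c * shuffleSign b c := by
  unfold shuffleSign
  rw [← pow_add, Finset.union_product, Finset.filter_union, Finset.card_union_of_disjoint]
  exact Finset.disjoint_filter_filter (Finset.disjoint_product.2 (Or.inl h))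

theorem shuffleSign_union_right {a b c : Finset (Fin n)} (h : Disjoint b c) :
    shuffleSign a (b ∪ c) = shuffleSign a b * shuffleSign a c := by
  unfold shuffleSign
  rw [← pow_add, Finset.product_union, Finset.filter_union, Finset.card_union_of_disjoint]
  exact Finset.disjoint_filter_filter (Finset.disjoint_product.2 (Or.inr h))

theorem mem_splits {B a : Finset (Fin n)} :
    a ∈ B.ssubsets.filter Finset.Nonempty ↔ a ⊂ B ∧ a.Nonempty := by
  simp

/-- The boundary of the boundary of a one-block symbol vanishes. -/
theorem boundary_blockBoundary (B : Finset (Fin n)) : boundary (blockBoundary B) = 0 := by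
  have key : boundary (blockBoundary B) =
      (∑ a ∈ B.ssubsets.filter Finset.Nonempty, ∑ c ∈ a.ssubsets.filter Finset.Nonempty,
        Finsupp.single [c, a \ c, B \ a] ((-1) ^ a.card * shuffleSign a (B \ a) *
          ((-1) ^ c.card * shuffleSign c (a \ c)))) +
      (∑ a ∈ B.ssubsets.filter Finset.Nonempty,
        ∑ c ∈ (B \ a).ssubsets.filter Finset.Nonempty,
        Finsupp.single [a, c, (B \ a) \ c] ((-1) ^ a.card * shuffleSign a (B \ a) *
          (-1) ^ (a.card - 1) * ((-1) ^ c.card * shuffleSign c ((B \ a) \ c)))) := by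
    conv_lhs => rw [blockBoundary, map_sum]
    rw [← Finset.sum_add_distrib]
    refine Finset.sum_congr rfl fun a _ => ?_
    have h := boundary_pair a (B \ a) ((-1) ^ a.card * shuffleSign a (B \ a))
      (Finsupp.single [] 1)
    have h0 : boundary (Finsupp.single ([] : Symbol n) 1) = 0 := by
      simp [boundary_single, symbolBoundary]
    have h1 : ∀ x : Chain n, concat x (Finsupp.single [] 1) = x := by
      intro x
      induction x using Finsupp.induction_linear with
      | zero => simp
      | add x x' hx hx' => simp [hx, hx']
      | single f a => simp [concat_single]
    rw [h0, h1, h1, h1, map_zero, smul_zero, add_zero] at h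
    rw [h]
    congr 1
    · rw [blockBoundary, map_sum, LinearMap.sum_apply, Finset.smul_sum]
      refine Finset.sum_congr rfl fun c _ => ?_
      simp only [concat_single, Finsupp.smul_single, smul_eq_mul, mul_one, one_mul,
        List.cons_append, List.nil_append]
    · rw [blockBoundary, map_sum, Finset.smul_sum]
      refine Finset.sum_congr rfl fun c _ => ?_
      simp only [concat_single, Finsupp.smul_single, smul_eq_mul, mul_one, one_mul,
        List.cons_append, List.nil_append]
  rw [key, Finset.sum_sigma', Finset.sum_sigma', add_eq_zero_iff_eq_neg,
    ← Finset.sum_neg_distrib]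
  refine Finset.sum_bij' (fun p _ => ⟨p.2, p.1 \ p.2⟩) (fun p _ => ⟨p.1 ∪ p.2, p.1⟩) ?_ ?_ ?_ ?_ ?_
  · rintro ⟨a, c⟩ h
    simp only [Finset.mem_sigma, mem_splits] at h ⊢
    obtain ⟨⟨haB, -⟩, hca, hc⟩ := h
    obtain ⟨x, hxB, hxa⟩ := Finset.exists_of_ssubset haB
    obtain ⟨y, hya, hyc⟩ := Finset.exists_of_ssubset hca
    refine ⟨⟨hca.trans haB, hc⟩, ?_, ⟨y, by simp [hya, hyc]⟩⟩
    refine (Finset.ssubset_iff_of_subset (Finset.sdiff_subset_sdiff haB.1 le_rfl)).2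
      ⟨x, ?_, by simp [hxa]⟩
    simp only [Finset.mem_sdiff]
    exact ⟨hxB, fun h => hxa (hca.1 h)⟩
  · rintro ⟨a, c⟩ h
    simp only [Finset.mem_sigma, mem_splits] at h ⊢
    obtain ⟨⟨haB, ha⟩, hcB, hc⟩ := h
    obtain ⟨x, hxB, hxc⟩ := Finset.exists_of_ssubset hcB
    simp only [Finset.mem_sdiff] at hxB
    obtain ⟨y, hy⟩ := hc
    have hy' := Finset.mem_sdiff.1 (hcB.1 hy)
    refine ⟨⟨?_, ha.mono Finset.subset_union_left⟩, ?_, ha⟩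
    · refine (Finset.ssubset_iff_of_subset (Finset.union_subset haB.1
        (hcB.1.trans Finset.sdiff_subset))).2 ⟨x, hxB.1, ?_⟩
      simp [hxB.2, hxc]
    · exact (Finset.ssubset_iff_of_subset Finset.subset_union_left).2 ⟨y, by simp [hy], hy'.2⟩
  · rintro ⟨a, c⟩ h
    simp only [Finset.mem_sigma, mem_splits] at h
    simp only [Finset.union_sdiff_of_subset h.2.1.1]
  · rintro ⟨a, c⟩ h
    simp only [Finset.mem_sigma, mem_splits] at h
    have hd : Disjoint a c := Finset.disjoint_sdiff.mono_right h.2.1.1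
    simp only [Finset.union_sdiff_cancel_left hd]
  · rintro ⟨a, c⟩ h
    simp only [Finset.mem_sigma, mem_splits] at h
    obtain ⟨⟨haB, -⟩, hca, hc⟩ := h
    have e1 : B \ c = (a \ c) ∪ (B \ a) := by
      ext x
      have := @hca.1 x
      have := @haB.1 x
      simp only [Finset.mem_sdiff, Finset.mem_union]
      tauto
    have e2 : (B \ c) \ (a \ c) = B \ a := by
      ext x
      have := @hca.1 x
      have := @haB.1 x
      simp only [Finset.mem_sdiff]
      tauto
    have d1 : Disjoint (a \ c) (B \ a) :=
      (Finset.disjoint_sdiff (s := a) (t := B)).mono_left Finset.sdiff_subset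
    have d2 : Disjoint c (a \ c) := Finset.disjoint_sdiff
    have e3 : a = c ∪ (a \ c) := (Finset.union_sdiff_of_subset hca.1).symm
    have e4 : a.card = c.card + (a \ c).card := by
      conv_lhs => rw [e3]
      exact Finset.card_union_of_disjoint d2
    have e5 : shuffleSign a (B \ a) = shuffleSign c (B \ a) * shuffleSign (a \ c) (B \ a) := by
      rw [← shuffleSign_union_left d2, ← e3]
    obtain ⟨m, hm⟩ : ∃ m, c.card = m + 1 := ⟨c.card - 1, by have := hc.card_pos; omega⟩
    rw [e2, ← Finsupp.single_neg]
    congr 1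
    rw [e1, shuffleSign_union_right d1, e5, e4, hm]
    have hsq : ((-1 : ℤ) ^ m) * (-1) ^ m = 1 := by
      rw [← mul_pow]; simp
    simp only [Nat.add_sub_cancel, pow_add, pow_one]
    linear_combination 0 * hsq

/-- On a one-block boundary followed by anything, the operator satisfies the Leibniz rule. -/
theorem boundary_concat_blockBoundary (B : Finset (Fin n)) (x : Chain n) :
    boundary (concat (blockBoundary B) x) =
      (-1 : ℤ) ^ B.card • concat (blockBoundary B) (boundary x) := by
  have h : boundary (concat (blockBoundary B) x) =
      concat (boundary (blockBoundary B)) x +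
      (-1 : ℤ) ^ B.card • concat (blockBoundary B) (boundary x) := by
    conv_lhs => rw [blockBoundary]
    conv_rhs => rw [blockBoundary]
    simp only [map_sum, LinearMap.sum_apply]
    rw [Finset.smul_sum, ← Finset.sum_add_distrib]
    refine Finset.sum_congr rfl fun a ha => ?_
    rw [mem_splits] at ha
    obtain ⟨haB, hane⟩ := ha
    have hcard : (B \ a).card + a.card = B.card := by
      rw [Finset.card_sdiff_add_card_eq_card haB.1]
    have hp : 0 < a.card := hane.card_pos
    have hq : a.card < B.card := Finset.card_lt_card haB
    rw [boundary_pair]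
    have h0 := boundary_pair a (B \ a) ((-1) ^ a.card * shuffleSign a (B \ a))
      (Finsupp.single [] 1)
    have hnil : boundary (Finsupp.single ([] : Symbol n) 1) = 0 := by
      simp [boundary_single, symbolBoundary]
    have h1 : ∀ x : Chain n, concat x (Finsupp.single [] 1) = x := by
      intro x
      induction x using Finsupp.induction_linear with
      | zero => simp
      | add x x' hx hx' => simp [hx, hx']
      | single f a => simp [concat_single]
    rw [hnil, h1, h1, h1, map_zero, smul_zero, add_zero] at h0
    rw [h0]
    simp only [map_add, map_smul, LinearMap.add_apply, LinearMap.smul_apply]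
    congr 1
    obtain ⟨p, hp'⟩ : ∃ p, a.card = p + 1 := ⟨a.card - 1, by omega⟩
    obtain ⟨q, hq'⟩ : ∃ q, (B \ a).card = q + 1 := ⟨(B \ a).card - 1, by omega⟩
    have hB : B.card = p + q + 2 := by omega
    have hs : ∀ c : ℤ, (Finsupp.single [a, B \ a] c : Chain n) =
      c • Finsupp.single [a, B \ a] 1 := by intro c; simp
    rw [hs ((-1) ^ a.card * shuffleSign a (B \ a)), hB, hp', hq']
    simp only [map_smul, LinearMap.smul_apply, smul_smul]
    congr 1
    simp only [Nat.add_sub_cancel]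
    ring
  rw [h, boundary_blockBoundary, map_zero, LinearMap.zero_apply, zero_add]

theorem boundary_symbolBoundary (f : Symbol n) : boundary (symbolBoundary f) = 0 := by
  induction f with
  | nil => simp [symbolBoundary]
  | cons B f ih =>
    rw [symbolBoundary, map_add, map_smul, boundary_cons, boundary_concat_blockBoundary, ih,
      boundary_single, one_smul, map_zero, smul_zero, add_zero, ← add_smul]
    rcases B.eq_empty_or_nonempty with rfl | hB
    · have : blockBoundary (∅ : Finset (Fin n)) = 0 := by
        rw [blockBoundary]
        exact Finset.sum_eq_zero fun a ha => absurd (mem_splits.1 ha).1 (Finset.not_ssubset_empty a)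
      simp [this]
    · obtain ⟨m, hm⟩ : ∃ m, B.card = m + 1 := ⟨B.card - 1, by have := hB.card_pos; omega⟩
      rw [hm]
      simp [pow_succ]

theorem boundary_boundary (x : Chain n) : boundary (boundary x) = 0 := by
  induction x using Finsupp.induction_linear with
  | zero => simp
  | add x y hx hy => simp [hx, hy]
  | single f a => rw [boundary_single, map_smul, boundary_symbolBoundary, smul_zero]

/-- `g` is obtained from `f` by splitting one block into two nonempty blocks. -/
def IsFace (g f : Symbol n) : Prop :=
  ∃ u v : Symbol n, ∃ B a : Finset (Fin n), a ⊂ B ∧ a.Nonempty ∧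
    f = u ++ B :: v ∧ g = u ++ a :: (B \ a) :: v

theorem symbolBoundary_mem (f : Symbol n) :
    symbolBoundary f ∈ Finsupp.supported ℤ ℤ {g | IsFace g f} := by
  induction f with
  | nil => exact Submodule.zero_mem _
  | cons B f ih =>
    rw [symbolBoundary]
    refine Submodule.add_mem _ ?_ (Submodule.smul_mem _ _ ?_)
    · rw [blockBoundary, map_sum, LinearMap.sum_apply]
      refine Submodule.sum_mem _ fun a ha => ?_
      rw [mem_splits] at ha
      rw [concat_single]
      exact Finsupp.single_mem_supported _ _ ⟨[], f, B, a, ha.1, ha.2, rfl, rfl⟩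
    · generalize symbolBoundary f = y at ih
      rw [Finsupp.supported_eq_span_single] at ih
      induction ih using Submodule.span_induction with
      | mem x hx =>
        obtain ⟨g, ⟨u, v, C, a, h1, h2, rfl, rfl⟩, rfl⟩ := hx
        rw [concat_single]
        exact Finsupp.single_mem_supported _ _ ⟨B :: u, v, C, a, h1, h2, rfl, rfl⟩
      | zero => simp
      | add x y _ _ hx hy => rw [map_add]; exact Submodule.add_mem _ hx hy
      | smul c x _ hx => rw [map_smul]; exact Submodule.smul_mem _ _ hx

theorem IsFace.mem_cells {W : Fin n → ℕ} {k d : ℕ} {g f : Symbol n} (h : IsFace g f)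
    (hf : f ∈ cells W k (d + 1)) : g ∈ cells W k d := by
  obtain ⟨u, v, B, a, haB, ha, rfl, rfl⟩ := h
  obtain ⟨⟨⟨h1, h2, h3⟩, h4⟩, h5⟩ := hf
  obtain ⟨x, hxB, hxa⟩ := Finset.exists_of_ssubset haB
  have hsub : B \ a ⊆ B := Finset.sdiff_subset
  refine ⟨⟨⟨?_, ?_, ?_⟩, ?_⟩, ?_⟩
  · intro C hC
    simp only [List.mem_append, List.mem_cons] at hC h1
    rcases hC with hC | rfl | rfl | hC
    · exact h1 C (Or.inl hC)
    · exact ha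
    · exact ⟨x, by simp [hxB, hxa]⟩
    · exact h1 C (Or.inr (Or.inr hC))
  · simp only [List.pairwise_append, List.pairwise_cons, List.mem_cons] at h2 ⊢
    obtain ⟨hu, ⟨hBv, hv⟩, huv⟩ := h2
    refine ⟨hu, ⟨?_, fun C hC => (hBv C hC).mono_left hsub, hv⟩, ?_⟩
    · rintro C (rfl | hC)
      · exact Finset.disjoint_sdiff
      · exact (hBv C hC).mono_left haB.1
    · rintro D hD C (rfl | rfl | hC)
      · exact (huv D hD B (Or.inl rfl)).mono_right haB.1
      · exact (huv D hD B (Or.inl rfl)).mono_right hsub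
      · exact huv D hD C (Or.inr hC)
  · intro i
    obtain ⟨C, hC, hi⟩ := h3 i
    simp only [List.mem_append, List.mem_cons] at hC ⊢
    rcases hC with hC | rfl | hC
    · exact ⟨C, Or.inl hC, hi⟩
    · by_cases hia : i ∈ a
      · exact ⟨a, Or.inr (Or.inl rfl), hia⟩
      · exact ⟨C \ a, Or.inr (Or.inr (Or.inl rfl)), by simp [hi, hia]⟩
    · exact ⟨C, Or.inr (Or.inr (Or.inr hC)), hi⟩
  · intro C hC
    simp only [List.mem_append, List.mem_cons] at hC h4
    rcases hC with hC | rfl | rfl | hC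
    · exact h4 C (Or.inl hC)
    · exact (Finset.sum_le_sum_of_subset haB.1).trans (h4 B (Or.inr (Or.inl rfl)))
    · exact (Finset.sum_le_sum_of_subset hsub).trans (h4 B (Or.inr (Or.inl rfl)))
    · exact h4 C (Or.inr (Or.inr hC))
  · simp only [List.length_append, List.length_cons] at h5 ⊢
    omega

theorem boundary_mem_chains (W : Fin n → ℕ) (k d : ℕ) :
    ∀ x ∈ chains W k (d + 1), boundary x ∈ chains W k d := by
  intro x hx
  rw [chains, Finsupp.supported_eq_span_single] at hx
  induction hx using Submodule.span_induction with
  | mem x hx =>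
    obtain ⟨f, hf, rfl⟩ := hx
    rw [boundary_single, one_smul]
    exact Finsupp.supported_mono (fun g hg => IsFace.mem_cells hg hf) (symbolBoundary_mem f)
  | zero => simp
  | add x y _ _ hx hy => rw [map_add]; exact Submodule.add_mem _ hx hy
  | smul c x _ hx => rw [map_smul]; exact Submodule.smul_mem _ _ hx

end lemmas

/-- The cellular chain complex `C_*(P(n, W, k))`, with integer coefficients. -/
noncomputable def cellularComplex {n : ℕ} (W : Fin n → ℕ) (k : ℕ) :
    ChainComplex (ModuleCat.{0} ℤ) ℕ :=
  ChainComplex.of (fun d => ModuleCat.of ℤ (chains W k d))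
    (fun d => ModuleCat.ofHom (boundary.restrict (boundary_mem_chains W k d)))
    (fun d => by
      refine ModuleCat.hom_ext (LinearMap.ext fun x => ?_)
      exact Subtype.ext (boundary_boundary x.1))

/-- The chain underlying a cellular cycle of `P(n, W, k)`. -/
noncomputable def cycleToChain {n : ℕ} {W : Fin n → ℕ} {k j : ℕ}
    (c : (cellularComplex W k).cycles j) : Chain n :=
  (show chains W k j from (cellularComplex W k).iCycles j c).1

/-- `IsFollower f i` says that the block of `f` in position `i` (counting from zero) is a follower:
the preceding block is a singleton which is not itself a follower, and whose element is smaller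
than every element of the block in position `i`. -/
def IsFollower {n : ℕ} (f : Symbol n) : ℕ → Prop
  | 0 => False
  | i + 1 => ¬ IsFollower f i ∧ ∃ (l : Fin n) (B : Finset (Fin n)),
      f[i]? = some {l} ∧ f[i + 1]? = some B ∧ ∀ b ∈ B, l < b

/-- Every block of `f` is either a singleton which is not a follower, or a follower which together
with its leader (the block just before it) has weight at least `k + 1`. -/
def IsCritical {n : ℕ} (W : Fin n → ℕ) (k : ℕ) (f : Symbol n) : Prop :=
  ∀ (i : ℕ) (B : Finset (Fin n)), f[i]? = some B →
    (B.card = 1 ∧ ¬ IsFollower f i) ∨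
    (IsFollower f i ∧ ∃ L : Finset (Fin n), f[i - 1]? = some L ∧
      k + 1 ≤ blockWeight W L + blockWeight W B)

open Classical in
/-- The chain `z(e)`: walking through `e` from left to right, it is the concatenation product of
the boundaries `∂(L ∪ B)` of the one-block symbols obtained by merging the leader-follower pairs
`L | B` of `e`, and of the remaining blocks of `e`. -/
noncomputable def basicCycle {n : ℕ} : Symbol n → Chain n
  | [] => Finsupp.single [] 1
  | [B] => Finsupp.single [B] 1
  | L :: B :: f =>
    if L.card = 1 ∧ ∀ l ∈ L, ∀ b ∈ B, l < b then
      concat (blockBoundary (L ∪ B)) (basicCycle f)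
    else concat (Finsupp.single [L] 1) (basicCycle (B :: f))

end WeightedPermutohedron

/-! The argument is an algebraic form of discrete Morse theory. Scan a cell from left to right,
passing over non-follower singletons and leader-follower pairs of weight above `k`. Either the scan
reaches the end (a critical cell), or it stops at a non-follower with at least two elements (an
upper cell), or it stops at a pair of weight at most `k`. In the last case merging the pair gives an
upper cell `u`, and splitting off the least element undoes the merge.

In each degree the cell basis is replaced by an adapted one: an upper cell `f` stays, a critical `e`
becomes `z(e)`, and a cell `g` matched with `u` becomes `∂u`. The leading terms of `z(e)` and `∂u`
are `±e` and `±g`; every other term is upper or has a lexicographically smaller key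
(`basicCycle_sub_mem_supported`, `IsMatched.symbolBoundary_sub_mem_supported`). Ranking upper cells
below everything makes the change of basis triangular with diagonal entries `±1`, hence invertible
over the integers.

In the adapted basis `∂` kills the critical and matched elements and carries the upper ones
bijectively to the matched ones of one degree lower. So the homology is free on the classes of the
`z(e)` (`exists_sub_mem_boundary`, `disjoint_span_basicCycle`). Monotone weights serve to keep
`z(e)` inside the complex (`blockWeight_le_of_ssubset_union`). -/

namespace WeightedPermutohedron

/-! ### Triangular families of integral chains -/

section triangular

variable {σ α : Type*} [LinearOrder α]

/-- In a vanishing combination, pick `f` of maximal rank in the support. No other member of the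
support contributes to the coordinate at `f`, so the coefficient of `f` times a sign is zero. Ranks
are compared only within a finite support, so `S` may be infinite. -/
theorem linearIndepOn_of_triangular {S : Set σ} {r : σ → α} {x : σ → σ →₀ ℤ}
    (h : ∀ f ∈ S, ∃ ε : ℤ, ε * ε = 1 ∧
      x f - Finsupp.single f ε ∈ Finsupp.supported ℤ ℤ {g | r g < r f}) :
    LinearIndepOn ℤ x S := by
  rw [linearIndepOn_iff]
  intro l hl h0
  by_contra hne
  obtain ⟨f, hf, hmax⟩ := l.support.exists_max_image r (Finsupp.support_nonempty_iff.2 hne)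
  have hfS : ∀ g ∈ l.support, g ∈ S := fun g hg => hl hg
  have key : ∀ g ∈ S, ¬ r f < r g → g ≠ f → x g f = 0 := by
    intro g hg hr hgf
    obtain ⟨ε, -, hx⟩ := h g hg
    by_contra hc
    have : (x g - Finsupp.single g ε) f ≠ 0 := by simp [hgf, hc]
    exact hr (hx (Finsupp.mem_support_iff.2 this))
  obtain ⟨ε, hε, hx⟩ := h f (hfS f hf)
  have hxf : x f f = ε := by
    by_contra hc
    have : (x f - Finsupp.single f ε) f ≠ 0 := by
      simpa [sub_eq_zero] using hc
    exact lt_irrefl _ (hx (Finsupp.mem_support_iff.2 this))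
  have h1 := DFunLike.congr_fun h0 f
  rw [Finsupp.linearCombination_apply, Finsupp.sum, Finsupp.finsetSum_apply,
    Finset.sum_eq_single f] at h1
  · simp only [Finsupp.smul_apply, hxf, smul_eq_mul, Finsupp.zero_apply, mul_eq_zero] at h1
    rcases h1 with h1 | h1
    · exact Finsupp.mem_support_iff.1 hf h1
    · simp [h1] at hε
  · intro g hg hgf
    simp [key g (hfS g hg) (not_lt.2 (hmax g hg)) hgf]
  · intro hf'
    exact absurd hf hf'

/-- Induction on the rank, solving for `f` in terms of `x f` and lower cells, which must again lie
in `S`. Finiteness of `S` supplies the well-foundedness: the lexicographic order on lists used later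
is not a well-order. -/
theorem supported_le_span_of_triangular {S : Set σ} (hS : S.Finite) {r : σ → α}
    {x : σ → σ →₀ ℤ}
    (h : ∀ f ∈ S, ∃ ε : ℤ, ε * ε = 1 ∧
      x f - Finsupp.single f ε ∈ Finsupp.supported ℤ ℤ {g | g ∈ S ∧ r g < r f}) :
    Finsupp.supported ℤ ℤ S ≤ Submodule.span ℤ (x '' S) := by
  have hwf : S.WellFoundedOn (fun a b => r a < r b) := by
    have : IsStrictOrder σ (fun a b => r a < r b) :=
      { irrefl := fun a => lt_irrefl _, trans := fun a b c => lt_trans }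
    exact hS.wellFoundedOn
  rw [Finsupp.supported_eq_span_single, Submodule.span_le]
  rintro _ ⟨f, hf, rfl⟩
  refine hwf.induction (P := fun f => Finsupp.single f 1 ∈ Submodule.span ℤ (x '' S)) hf
    fun f hf ih => ?_
  obtain ⟨ε, hε, hx⟩ := h f hf
  have h1 : x f - Finsupp.single f ε ∈ Submodule.span ℤ (x '' S) := by
    rw [Finsupp.supported_eq_span_single] at hx
    refine Submodule.span_le.2 ?_ hx
    rintro _ ⟨g, ⟨hg, hr⟩, rfl⟩
    exact ih g hg hr
  have h2 : x f ∈ Submodule.span ℤ (x '' S) := Submodule.subset_span ⟨f, hf, rfl⟩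
  have h3 : (Finsupp.single f 1 : σ →₀ ℤ) = ε • (x f - (x f - Finsupp.single f ε)) := by
    simp [hε]
  rw [h3]
  exact Submodule.smul_mem _ _ (Submodule.sub_mem _ h2 h1)

end triangular

/-! ### Critical, upper and matched symbols -/

variable {n : ℕ}

/-- `L` is a singleton whose element is smaller than every element of `B`. -/
def Leads (L B : Finset (Fin n)) : Prop := L.card = 1 ∧ ∀ l ∈ L, ∀ b ∈ B, l < b

/-- The leader-follower scan of the symbol stops at a non-follower with at least two elements. -/
inductive IsUpper (W : Fin n → ℕ) (k : ℕ) : Symbol n → Prop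
  | head {B f} : 2 ≤ B.card → IsUpper W k (B :: f)
  | pair {L B f} : Leads L B → k < blockWeight W L + blockWeight W B → IsUpper W k f →
      IsUpper W k (L :: B :: f)
  | cons {L B f} : L.card = 1 → ¬ Leads L B → IsUpper W k (B :: f) → IsUpper W k (L :: B :: f)

/-- `u` is obtained from `g` by merging the first leader-follower pair of weight at most `k`,
where everything before it consists of single non-followers and heavy pairs. -/
inductive IsMatched (W : Fin n → ℕ) (k : ℕ) : Symbol n → Symbol n → Prop
  | merge {L B C f} : Leads L B → blockWeight W L + blockWeight W B ≤ k → B.Nonempty →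
      C = L ∪ B → IsMatched W k (L :: B :: f) (C :: f)
  | pair {L B g u} : Leads L B → k < blockWeight W L + blockWeight W B → IsMatched W k g u →
      IsMatched W k (L :: B :: g) (L :: B :: u)
  | cons {L B C g u} : L.card = 1 → ¬ Leads L B → ¬ Leads L C →
      IsMatched W k (B :: g) (C :: u) → IsMatched W k (L :: B :: g) (L :: C :: u)

/-- A recursive form of `IsCritical`. -/
inductive IsCrit (W : Fin n → ℕ) (k : ℕ) : Symbol n → Prop
  | nil : IsCrit W k []
  | single {L} : L.card = 1 → IsCrit W k [L]
  | pair {L B f} : Leads L B → k < blockWeight W L + blockWeight W B → IsCrit W k f →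
      IsCrit W k (L :: B :: f)
  | cons {L B f} : L.card = 1 → ¬ Leads L B → IsCrit W k (B :: f) → IsCrit W k (L :: B :: f)

variable {W : Fin n → ℕ} {k : ℕ}

theorem Leads.disjoint {L B : Finset (Fin n)} (h : Leads L B) : Disjoint L B :=
  Finset.disjoint_left.2 fun x hL hB => lt_irrefl _ (h.2 x hL x hB)

theorem Leads.two_le_card_union {L B : Finset (Fin n)} (h : Leads L B) (hB : B.Nonempty) :
    2 ≤ (L ∪ B).card := by
  rw [Finset.card_union_of_disjoint h.disjoint, h.1]
  have := hB.card_pos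
  omega

theorem blockWeight_union {L B : Finset (Fin n)} (h : Disjoint L B) :
    blockWeight W (L ∪ B) = blockWeight W L + blockWeight W B :=
  Finset.sum_union h

/-- Merging a leader into its follower preserves the least element of the block, and leading a block
depends only on that element. So a singleton in front sees no difference between the two symbols,
and the matching extends leftward past it. -/
theorem IsMatched.exists_cons {g u : Symbol n} (h : IsMatched W k g u) :
    ∃ B g' C u', g = B :: g' ∧ u = C :: u' ∧ ∀ L, Leads L B ↔ Leads L C := by
  cases h with
  | @merge L B C f h _ _ hC =>
    subst hC
    refine ⟨_, _, _, _, rfl, rfl, fun M => ⟨fun hM => ⟨hM.1, fun m hm c hc => ?_⟩,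
      fun hM => ⟨hM.1, fun m hm c hc => hM.2 m hm c (Finset.mem_union_left _ hc)⟩⟩⟩
    rcases Finset.mem_union.1 hc with hc | hc
    · exact hM.2 m hm c hc
    · obtain ⟨l, hl⟩ : L.Nonempty := Finset.card_pos.1 (by have := h.1; omega)
      exact (hM.2 m hm l hl).trans (h.2 l hl c hc)
  | pair => exact ⟨_, _, _, _, rfl, rfl, fun _ => Iff.rfl⟩
  | cons => exact ⟨_, _, _, _, rfl, rfl, fun _ => Iff.rfl⟩

/-- The scan is deterministic, so its three outcomes exclude one another; this lemma and the next
two treat the pairs of outcomes. -/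
theorem IsMatched.not_isUpper {g u : Symbol n} (h : IsMatched W k g u) : ¬ IsUpper W k g := by
  induction h with
  | merge h hw hB hC =>
    intro hu
    cases hu with
    | head h2 => have := h.1; omega
    | pair _ hw' => omega
    | cons _ h' => exact h' h
  | pair h hw _ ih =>
    intro hu
    cases hu with
    | head h2 => have := h.1; omega
    | pair _ _ hu => exact ih hu
    | cons _ h' => exact h' h
  | cons h1 h hC _ ih =>
    intro hu
    cases hu with
    | head h2 => omega
    | pair h' => exact h h'
    | cons _ _ hu => exact ih hu

theorem IsMatched.not_isCrit {g u : Symbol n} (h : IsMatched W k g u) : ¬ IsCrit W k g := by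
  induction h with
  | merge h hw hB hC =>
    intro hu
    cases hu with
    | pair _ hw' => omega
    | cons _ h' => exact h' h
  | pair h hw _ ih =>
    intro hu
    cases hu with
    | pair _ _ hu => exact ih hu
    | cons _ h' => exact h' h
  | cons h1 h hC _ ih =>
    intro hu
    cases hu with
    | pair h' => exact h h'
    | cons _ _ hu => exact ih hu

theorem IsCrit.not_isUpper {g : Symbol n} (h : IsCrit W k g) : ¬ IsUpper W k g := by
  induction h with
  | nil => intro hu; cases hu
  | single h1 =>
    intro hu
    cases hu with
    | head h2 => omega
  | pair h hw _ ih =>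
    intro hu
    cases hu with
    | head h2 => have := h.1; omega
    | pair _ _ hu => exact ih hu
    | cons _ h' => exact h' h
  | cons h1 h _ ih =>
    intro hu
    cases hu with
    | head h2 => omega
    | pair h' => exact h h'
    | cons _ _ hu => exact ih hu

theorem IsMatched.right_unique {g u v : Symbol n} (h : IsMatched W k g u)
    (h' : IsMatched W k g v) : u = v := by
  induction h generalizing v with
  | merge h hw hB hC =>
    cases h' with
    | merge _ _ _ hC' => rw [hC, hC']
    | pair _ hw' => omega
    | cons _ h' => exact absurd h h'
  | pair h hw _ ih =>
    cases h' with
    | merge => omega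
    | pair _ _ h' => rw [ih h']
    | cons _ h' => exact absurd h h'
  | cons h1 h hC _ ih =>
    cases h' with
    | merge h' => exact absurd h' h
    | pair h' => exact absurd h' h
    | cons _ _ _ h' => rw [ih h']

theorem IsUpper.exists_isMatched {u : Symbol n} (h : IsUpper W k u)
    (hw : ∀ B ∈ u, blockWeight W B ≤ k) : ∃ g, IsMatched W k g u := by
  induction h with
  | @head C f h2 =>
    have hne : C.Nonempty := Finset.card_pos.1 (by omega)
    -- A leader lies below its whole follower, so the only way to undo the merge is to split off the
    -- minimum.
    have hC : C = {C.min' hne} ∪ C.erase (C.min' hne) := by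
      rw [← Finset.insert_eq, Finset.insert_erase (C.min'_mem hne)]
    have hl : Leads {C.min' hne} (C.erase (C.min' hne)) := by
      refine ⟨by simp, fun l hl b hb => ?_⟩
      rw [Finset.mem_singleton.1 hl]
      exact C.min'_lt_of_mem_erase_min' hne hb
    refine ⟨_, .merge hl ?_ ?_ hC⟩
    · rw [← blockWeight_union hl.disjoint, ← hC]
      exact hw C (by simp)
    · refine Finset.card_pos.1 ?_
      rw [Finset.card_erase_of_mem (C.min'_mem hne)]
      omega
  | pair h hk _ ih =>
    obtain ⟨g, hg⟩ := ih fun B hB => hw B (by simp [hB])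
    exact ⟨_, .pair h hk hg⟩
  | cons h1 h _ ih =>
    obtain ⟨g, hg⟩ := ih fun B hB => hw B (List.mem_cons_of_mem _ hB)
    obtain ⟨B, g', C, u', rfl, e, hL⟩ := hg.exists_cons
    obtain ⟨rfl, rfl⟩ := List.cons_eq_cons.1 e
    exact ⟨_, .cons h1 (by rwa [hL]) h hg⟩

/-- These are the possible ends of the scan: running out of blocks, a large non-follower, or a light
pair. -/
theorem isCrit_or_isUpper_or_isMatched : ∀ f : Symbol n, (∀ B ∈ f, B.Nonempty) →
    IsCrit W k f ∨ IsUpper W k f ∨ ∃ u, IsMatched W k f u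
  | [], _ => Or.inl .nil
  | [B], h => by
    have := (h B (by simp)).card_pos
    rcases Nat.lt_or_ge B.card 2 with h2 | h2
    · exact Or.inl (.single (by omega))
    · exact Or.inr (Or.inl (.head h2))
  | L :: B :: f, h => by
    have := (h L (by simp)).card_pos
    rcases Nat.lt_or_ge L.card 2 with h2 | h2
    swap
    · exact Or.inr (Or.inl (.head h2))
    have h1 : L.card = 1 := by omega
    by_cases hL : Leads L B
    · rcases Nat.lt_or_ge k (blockWeight W L + blockWeight W B) with hk | hk
      · rcases isCrit_or_isUpper_or_isMatched f fun C hC => h C (by simp [hC]) with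
          h | h | ⟨u, h⟩
        · exact Or.inl (.pair hL hk h)
        · exact Or.inr (Or.inl (.pair hL hk h))
        · exact Or.inr (Or.inr ⟨_, .pair hL hk h⟩)
      · exact Or.inr (Or.inr ⟨_, .merge hL hk (h B (by simp)) rfl⟩)
    · rcases isCrit_or_isUpper_or_isMatched (B :: f)
        fun C hC => h C (List.mem_cons_of_mem _ hC) with h | h | ⟨u, h⟩
      · exact Or.inl (.cons h1 hL h)
      · exact Or.inr (Or.inl (.cons h1 hL h))
      · obtain ⟨B', g', C, u', e, rfl, hLC⟩ := h.exists_cons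
        obtain ⟨rfl, rfl⟩ := List.cons_eq_cons.1 e
        exact Or.inr (Or.inr ⟨_, .cons h1 hL (by rwa [← hLC]) h⟩)

/-- Forgets the conditions on the prefix, which play no role in checking faces and cells. -/
theorem IsMatched.exists_append {g u : Symbol n} (h : IsMatched W k g u) :
    ∃ (p : Symbol n) (L B : Finset (Fin n)) (f : Symbol n), Leads L B ∧ B.Nonempty ∧
      blockWeight W L + blockWeight W B ≤ k ∧ g = p ++ L :: B :: f ∧ u = p ++ (L ∪ B) :: f := by
  induction h with
  | merge h hw hB hC => exact ⟨[], _, _, _, h, hB, hw, rfl, by simp [hC]⟩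
  | @pair L B _ _ _ _ _ ih =>
    obtain ⟨p, L', B', f, h1, h2, h3, rfl, rfl⟩ := ih
    exact ⟨L :: B :: p, L', B', f, h1, h2, h3, rfl, rfl⟩
  | @cons L B _ _ _ _ _ _ _ ih =>
    obtain ⟨p, L', B', f, h1, h2, h3, e, e'⟩ := ih
    exact ⟨L :: p, L', B', f, h1, h2, h3, by simp [e], by simp [e']⟩

theorem IsMatched.isFace {g u : Symbol n} (h : IsMatched W k g u) : IsFace g u := by
  obtain ⟨p, L, B, f, h1, ⟨b, hb⟩, -, rfl, rfl⟩ := h.exists_append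
  refine ⟨p, f, L ∪ B, L, ?_, Finset.card_pos.1 (by have := h1.1; omega), rfl, ?_⟩
  · refine (Finset.ssubset_iff_of_subset Finset.subset_union_left).2 ⟨b, by simp [hb], ?_⟩
    exact Finset.disjoint_right.1 h1.disjoint hb
  · rw [Finset.union_sdiff_cancel_left h1.disjoint]

theorem IsMatched.mem_cells {g u : Symbol n} {d : ℕ} (h : IsMatched W k g u)
    (hg : g ∈ cells W k d) : u ∈ cells W k (d + 1) := by
  obtain ⟨p, L, B, f, h1, hB, hw, rfl, rfl⟩ := h.exists_append
  obtain ⟨⟨⟨h2, h3, h4⟩, h5⟩, h6⟩ := hg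
  simp only [List.mem_append, List.mem_cons] at h2 h4 h5
  refine ⟨⟨⟨?_, ?_, ?_⟩, ?_⟩, ?_⟩
  · intro C hC
    simp only [List.mem_append, List.mem_cons] at hC
    rcases hC with hC | rfl | hC
    · exact h2 C (by simp [hC])
    · exact hB.mono Finset.subset_union_right
    · exact h2 C (by simp [hC])
  · simp only [List.pairwise_append, List.pairwise_cons, List.mem_cons] at h3 ⊢
    obtain ⟨hp, ⟨hL, hB, hf⟩, hpf⟩ := h3
    refine ⟨hp, ⟨fun C hC => Finset.disjoint_union_left.2 ⟨hL C (Or.inr hC), hB C hC⟩, hf⟩, ?_⟩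
    rintro D hD C (rfl | hC)
    · exact Finset.disjoint_union_right.2
        ⟨hpf D hD L (Or.inl rfl), hpf D hD B (Or.inr (Or.inl rfl))⟩
    · exact hpf D hD C (Or.inr (Or.inr hC))
  · intro i
    obtain ⟨C, hC, hi⟩ := h4 i
    simp only [List.mem_append, List.mem_cons]
    rcases hC with hC | rfl | rfl | hC
    · exact ⟨C, Or.inl hC, hi⟩
    · exact ⟨_, Or.inr (Or.inl rfl), Finset.mem_union_left _ hi⟩
    · exact ⟨_, Or.inr (Or.inl rfl), Finset.mem_union_right _ hi⟩
    · exact ⟨C, Or.inr (Or.inr hC), hi⟩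
  · intro C hC
    simp only [List.mem_append, List.mem_cons] at hC
    rcases hC with hC | rfl | hC
    · exact h5 C (by simp [hC])
    · rwa [blockWeight_union h1.disjoint]
    · exact h5 C (by simp [hC])
  · simp only [List.length_append, List.length_cons] at h6 ⊢
    omega

/-! ### Agreement of the positional and recursive notions of critical symbol -/

theorem isCritical_singleton {L : Finset (Fin n)} : IsCritical W k [L] ↔ L.card = 1 := by
  constructor
  · intro h
    rcases h 0 L rfl with h | h
    · exact h.1
    · exact h.1.elim
  · rintro h (_ | i) B hB
    · cases hB
      exact Or.inl ⟨h, id⟩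
    · simp at hB

theorem isFollower_one {L B : Finset (Fin n)} {f : Symbol n} :
    IsFollower (L :: B :: f) 1 ↔ Leads L B := by
  constructor
  · rintro ⟨-, l, C, h1, h2, h3⟩
    cases h1
    cases h2
    exact ⟨by simp, fun l' hl' b hb => by rw [Finset.mem_singleton.1 hl']; exact h3 b hb⟩
  · intro h
    obtain ⟨l, rfl⟩ := Finset.card_eq_one.1 h.1
    exact ⟨id, l, B, rfl, rfl, fun b hb => h.2 l (by simp) b hb⟩

/-- A follower cannot be a leader, so after a pair the scan restarts as at the beginning of a
symbol. -/
theorem isFollower_add_two {L B : Finset (Fin n)} {f : Symbol n} (h : Leads L B) (i : ℕ) :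
    IsFollower (L :: B :: f) (i + 2) ↔ IsFollower f i := by
  induction i with
  | zero =>
    refine ⟨fun h' => ?_, fun h' => h'.elim⟩
    exact absurd (isFollower_one.2 h) h'.1
  | succ i ih =>
    rw [IsFollower, ih]
    rfl

theorem isFollower_add_one {L B : Finset (Fin n)} {f : Symbol n} (h : ¬ Leads L B) (i : ℕ) :
    IsFollower (L :: B :: f) (i + 1) ↔ IsFollower (B :: f) i := by
  induction i with
  | zero => exact ⟨fun h' => h (isFollower_one.1 h'), fun h' => h'.elim⟩
  | succ i ih =>
    rw [IsFollower, ih]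
    rfl

theorem isCritical_pair {L B : Finset (Fin n)} {f : Symbol n} (h : Leads L B) :
    IsCritical W k (L :: B :: f) ↔
      k < blockWeight W L + blockWeight W B ∧ IsCritical W k f := by
  constructor
  · intro hc
    refine ⟨?_, fun i C hC => ?_⟩
    · rcases hc 1 B rfl with h' | ⟨-, L', hL', hw⟩
      · exact absurd (isFollower_one.2 h) h'.2
      · cases hL'
        exact hw
    · have := hc (i + 2) C hC
      rw [isFollower_add_two h] at this
      refine this.imp_right fun ⟨h1, h2⟩ => ⟨h1, ?_⟩
      -- At `i = 0` the truncated `i - 1` would look up the wrong block, but an initial block is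
      -- never a follower.
      cases i with
      | zero => exact h1.elim
      | succ i => exact h2
  · rintro ⟨hw, hc⟩ (_ | _ | i) C hC
    · cases hC
      exact Or.inl ⟨h.1, id⟩
    · cases hC
      exact Or.inr ⟨isFollower_one.2 h, L, rfl, hw⟩
    · rw [isFollower_add_two h]
      refine (hc i C hC).imp_right fun ⟨h1, h2⟩ => ⟨h1, ?_⟩
      cases i with
      | zero => exact h1.elim
      | succ i => exact h2

theorem isCritical_cons {L B : Finset (Fin n)} {f : Symbol n} (h : ¬ Leads L B) :
    IsCritical W k (L :: B :: f) ↔ L.card = 1 ∧ IsCritical W k (B :: f) := by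
  constructor
  · intro hc
    refine ⟨?_, fun i C hC => ?_⟩
    · rcases hc 0 L rfl with h' | h'
      · exact h'.1
      · exact h'.1.elim
    · have := hc (i + 1) C hC
      rw [isFollower_add_one h] at this
      refine this.imp_right fun ⟨h1, h2⟩ => ⟨h1, ?_⟩
      cases i with
      | zero => exact h1.elim
      | succ i => exact h2
  · rintro ⟨h1, hc⟩ (_ | i) C hC
    · cases hC
      exact Or.inl ⟨h1, id⟩
    · rw [isFollower_add_one h]
      refine (hc i C hC).imp_right fun ⟨h1, h2⟩ => ⟨h1, ?_⟩
      cases i with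
      | zero => exact h1.elim
      | succ i => exact h2

theorem isCritical_iff_isCrit : ∀ f : Symbol n, IsCritical W k f ↔ IsCrit W k f
  | [] => ⟨fun _ => .nil, fun _ i B hB => by simp at hB⟩
  | [L] => isCritical_singleton.trans ⟨.single, fun h => by cases h; assumption⟩
  | L :: B :: f => by
    by_cases h : Leads L B
    · rw [isCritical_pair h, isCritical_iff_isCrit f]
      refine ⟨fun h' => .pair h h'.1 h'.2, fun h' => ?_⟩
      cases h' with
      | pair _ hw hf => exact ⟨hw, hf⟩
      | cons _ h' => exact absurd h h'
    · rw [isCritical_cons h, isCritical_iff_isCrit (B :: f)]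
      refine ⟨fun h' => .cons h'.1 h h'.2, fun h' => ?_⟩
      cases h' with
      | pair h' => exact absurd h' h
      | cons h1 _ hf => exact ⟨h1, hf⟩

/-! ### The chains `z(e)` are cycles -/

theorem basicCycle_pair {L B : Finset (Fin n)} {f : Symbol n} (h : Leads L B) :
    basicCycle (L :: B :: f) = concat (blockBoundary (L ∪ B)) (basicCycle f) := by
  rw [basicCycle]
  exact if_pos h

theorem basicCycle_cons {L B : Finset (Fin n)} {f : Symbol n} (h : ¬ Leads L B) :
    basicCycle (L :: B :: f) = concat (Finsupp.single [L] 1) (basicCycle (B :: f)) := by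
  rw [basicCycle]
  exact if_neg h

theorem blockBoundary_of_card_eq_one {L : Finset (Fin n)} (h : L.card = 1) :
    blockBoundary L = 0 := by
  rw [blockBoundary]
  refine Finset.sum_eq_zero fun a ha => ?_
  obtain ⟨h1, h2⟩ := mem_splits.1 ha
  have := Finset.card_lt_card h1
  have := h2.card_pos
  omega

/-- By the Leibniz rule, since every factor is a cycle: either the boundary of a block or a single
point. -/
theorem boundary_basicCycle {e : Symbol n} (h : IsCrit W k e) : boundary (basicCycle e) = 0 := by
  induction h with
  | nil => simp [basicCycle, boundary_single, symbolBoundary]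
  | single h1 =>
    rw [basicCycle, boundary_single, symbolBoundary_block, blockBoundary_of_card_eq_one h1,
      smul_zero]
  | pair h _ _ ih =>
    rw [basicCycle_pair h, boundary_concat_blockBoundary, ih, map_zero, smul_zero]
  | cons h1 h _ ih =>
    rw [basicCycle_cons h, boundary_cons, blockBoundary_of_card_eq_one h1, ih]
    simp

/-! ### Supports, keys and leading terms -/

/-- A product of chains is supported on `U` if the concatenations of their symbols lie in `U`. -/
theorem concat_mem_supported {S T U : Set (Symbol n)} {x y : Chain n}
    (hx : x ∈ Finsupp.supported ℤ ℤ S) (hy : y ∈ Finsupp.supported ℤ ℤ T)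
    (h : ∀ f ∈ S, ∀ g ∈ T, f ++ g ∈ U) : concat x y ∈ Finsupp.supported ℤ ℤ U := by
  rw [Finsupp.supported_eq_span_single] at hx
  induction hx using Submodule.span_induction with
  | mem x hx =>
    obtain ⟨f, hf, rfl⟩ := hx
    rw [Finsupp.supported_eq_span_single] at hy
    induction hy using Submodule.span_induction with
    | mem y hy =>
      obtain ⟨g, hg, rfl⟩ := hy
      rw [concat_single]
      exact Finsupp.single_mem_supported _ _ (h f hf g hg)
    | zero => simp
    | add x y _ _ hx hy => rw [map_add]; exact Submodule.add_mem _ hx hy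
    | smul c x _ hx => rw [map_smul]; exact Submodule.smul_mem _ _ hx
  | zero => simp
  | add x y _ _ hx hy => rw [map_add, LinearMap.add_apply]; exact Submodule.add_mem _ hx hy
  | smul c x _ hx => rw [map_smul, LinearMap.smul_apply]; exact Submodule.smul_mem _ _ hx

theorem blockBoundary_mem_supported (B : Finset (Fin n)) :
    blockBoundary B ∈ Finsupp.supported ℤ ℤ {f | ∃ a, a ⊂ B ∧ a.Nonempty ∧ f = [a, B \ a]} := by
  rw [blockBoundary]
  refine Submodule.sum_mem _ fun a ha => ?_
  obtain ⟨h1, h2⟩ := mem_splits.1 ha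
  exact Finsupp.single_mem_supported _ _ ⟨a, h1, h2, rfl⟩

/-- The split off of the leader is the leading term of the boundary of a merged block. -/
theorem blockBoundary_sub_mem_supported {L B : Finset (Fin n)} (h : Leads L B)
    (hB : B.Nonempty) : ∃ ε : ℤ, ε * ε = 1 ∧
      blockBoundary (L ∪ B) - Finsupp.single [L, B] ε ∈
        Finsupp.supported ℤ ℤ {f | ∃ a, a ⊂ L ∪ B ∧ a.Nonempty ∧ a ≠ L ∧ f = [a, (L ∪ B) \ a]} := by
  have hL : L ∈ (L ∪ B).ssubsets.filter Finset.Nonempty := by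
    rw [mem_splits]
    obtain ⟨b, hb⟩ := hB
    refine ⟨(Finset.ssubset_iff_of_subset Finset.subset_union_left).2 ⟨b, by simp [hb], ?_⟩,
      Finset.card_pos.1 (by have := h.1; omega)⟩
    exact Finset.disjoint_right.1 h.disjoint hb
  have e : (L ∪ B) \ L = B := Finset.union_sdiff_cancel_left h.disjoint
  refine ⟨(-1) ^ L.card * shuffleSign L B, ?_, ?_⟩
  · rw [shuffleSign, ← pow_add, ← mul_pow]
    simp
  · rw [blockBoundary, ← Finset.add_sum_erase _ _ hL, e, add_sub_cancel_left]
    refine Submodule.sum_mem _ fun a ha => ?_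
    obtain ⟨h0, ha⟩ := Finset.mem_erase.1 ha
    obtain ⟨h1, h2⟩ := mem_splits.1 ha
    exact Finsupp.single_mem_supported _ _ ⟨a, h1, h2, h0, rfl⟩

/-- An integer recording the least element of a block, and its cardinality. -/
def blockKey (B : Finset (Fin n)) : ℕ := (B.sup fun b => n - b.1) * (n + 1) + B.card

theorem blockKey_lt_of_ssubset {a B : Finset (Fin n)} (h : a ⊂ B) : blockKey a < blockKey B :=
  add_lt_add_of_le_of_lt (Nat.mul_le_mul_right _ (Finset.sup_mono h.1)) (Finset.card_lt_card h)

/-- A smaller least element means a larger key. Cardinalities are at most `n`, so the factor `n + 1`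
prevents them from outweighing a difference in least elements. -/
theorem blockKey_lt {l : Fin n} {a B : Finset (Fin n)} (ha : ∀ i ∈ a, l < i)
    (hB : ∃ b ∈ B, b ≤ l) : blockKey a < blockKey B := by
  obtain ⟨b, hb, hbl⟩ := hB
  have hl := l.2
  have h1 : (a.sup fun i => n - i.1) < n - l.1 := by
    rw [Finset.sup_lt_iff (by rw [Nat.bot_eq_zero]; omega)]
    intro i hi
    have := Fin.lt_def.1 (ha i hi)
    omega
  have h2 : n - b.1 ≤ B.sup fun i => n - i.1 := Finset.le_sup (f := fun i : Fin n => n - i.1) hb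
  have h3 := Fin.le_def.1 hbl
  have h4 : a.card ≤ n := by simpa using a.card_le_univ
  have h5 : ((a.sup fun i => n - i.1) + 1) * (n + 1) ≤ (B.sup fun i => n - i.1) * (n + 1) :=
    Nat.mul_le_mul_right _ (by omega)
  unfold blockKey
  rw [add_mul] at h5
  omega

/-- The key of a symbol; keys are compared lexicographically. -/
def symbolKey (f : Symbol n) : List ℕ := f.map blockKey

theorem symbolKey_cons_lt {a B : Finset (Fin n)} {f g : Symbol n} :
    symbolKey (a :: f) < symbolKey (B :: g) ↔
      blockKey a < blockKey B ∨ blockKey a = blockKey B ∧ symbolKey f < symbolKey g := by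
  simp only [symbolKey, List.map_cons, List.cons_lt_cons_iff]

/-- Symbols that are negligible compared to `f`. -/
def negligible (W : Fin n → ℕ) (k : ℕ) (f : Symbol n) : Set (Symbol n) :=
  {g | IsUpper W k g ∨ symbolKey g < symbolKey f}

theorem pair_mem_negligible {L B : Finset (Fin n)} {f g : Symbol n} (h : Leads L B)
    (hk : k < blockWeight W L + blockWeight W B) (hg : g ∈ negligible W k f) :
    L :: B :: g ∈ negligible W k (L :: B :: f) := by
  rcases hg with hg | hg
  · exact Or.inl (.pair h hk hg)
  · exact Or.inr (by simp [symbolKey_cons_lt, hg])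

/-- The danger is that `L` leads the first block `C` of an upper `g`, turning `C` into a follower.
Then all of `C` lies above `L` while `B` has an element not above it, so the key drops at that
position instead. -/
theorem cons_mem_negligible {L B : Finset (Fin n)} {f g : Symbol n} (h1 : L.card = 1)
    (h : ¬ Leads L B) (hg : g ∈ negligible W k (B :: f)) :
    L :: g ∈ negligible W k (L :: B :: f) := by
  rcases hg with hg | hg
  · cases g with
    | nil => cases hg
    | cons C g =>
      by_cases hC : Leads L C
      · refine Or.inr ?_
        rw [symbolKey_cons_lt]
        refine Or.inr ⟨rfl, ?_⟩
        rw [symbolKey_cons_lt]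
        obtain ⟨l, rfl⟩ := Finset.card_eq_one.1 h1
        simp only [Leads, Finset.card_singleton, Finset.mem_singleton, forall_eq, true_and,
          not_forall, not_lt] at h hC
        obtain ⟨b, hb, hbl⟩ := h
        exact Or.inl (blockKey_lt hC ⟨b, hb, hbl⟩)
      · exact Or.inl (.cons h1 hC hg)
  · exact Or.inr (by rw [symbolKey_cons_lt]; exact Or.inr ⟨rfl, hg⟩)

/-- If `a` contains the leader's element it has a second one, so it stops the scan at once;
otherwise its least element is larger than the leader's and the key drops. The tails `f` and `g` are
irrelevant. -/
theorem split_mem_negligible {L B a : Finset (Fin n)} {f g : Symbol n} (h : Leads L B)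
    (ha : a ⊂ L ∪ B) (hL : a ≠ L) : a :: g ∈ negligible W k (L :: f) := by
  obtain ⟨l, rfl⟩ := Finset.card_eq_one.1 h.1
  by_cases hl : l ∈ a
  · refine Or.inl (.head ?_)
    by_contra hc
    exact hL (Finset.eq_of_subset_of_card_le (Finset.singleton_subset_iff.2 hl) (by simp; omega)).symm
  · refine Or.inr ?_
    rw [symbolKey_cons_lt]
    refine Or.inl (blockKey_lt (l := l) (fun i hi => ?_) ⟨l, by simp, le_rfl⟩)
    rcases Finset.mem_union.1 (ha.1 hi) with h' | h'
    · exact absurd (Finset.mem_singleton.1 h' ▸ hi) hl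
    · exact h.2 l (by simp) i h'

theorem concat_smul_single (f : Symbol n) (ε : ℤ) (x : Chain n) :
    concat (Finsupp.single f ε) x = ε • concat (Finsupp.single f 1) x := by
  rw [← LinearMap.smul_apply, ← map_smul]
  simp

theorem single_mem_supported_singleton (f : Symbol n) (ε : ℤ) :
    (Finsupp.single f ε : Chain n) ∈ Finsupp.supported ℤ ℤ {f} :=
  Finsupp.single_mem_supported _ _ rfl

theorem basicCycle_sub_mem_supported {e : Symbol n} (h : IsCrit W k e)
    (hne : ∀ B ∈ e, B.Nonempty) : ∃ ε : ℤ, ε * ε = 1 ∧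
      basicCycle e - Finsupp.single e ε ∈ Finsupp.supported ℤ ℤ (negligible W k e) := by
  induction h with
  | nil => exact ⟨1, rfl, by simp [basicCycle]⟩
  | single => exact ⟨1, rfl, by simp [basicCycle]⟩
  | @pair L B f h hk _ ih =>
    obtain ⟨ε, hε, hx⟩ := ih fun C hC => hne C (by simp [hC])
    obtain ⟨δ, hδ, hy⟩ := blockBoundary_sub_mem_supported h (hne B (by simp))
    refine ⟨δ * ε, by rw [mul_mul_mul_comm, hδ, hε, one_mul], ?_⟩
    -- The identity `xy - x₀y₀ = (x - x₀)y + x₀(y - y₀)`, with `x₀`, `y₀` the leading terms.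
    have e1 : basicCycle (L :: B :: f) - Finsupp.single (L :: B :: f) (δ * ε) =
        concat (blockBoundary (L ∪ B) - Finsupp.single [L, B] δ) (basicCycle f) +
        concat (Finsupp.single [L, B] δ) (basicCycle f - Finsupp.single f ε) := by
      rw [basicCycle_pair h]
      simp only [map_sub, LinearMap.sub_apply, concat_single, List.cons_append, List.nil_append]
      abel
    rw [e1]
    refine Submodule.add_mem _ ?_ ?_
    · refine concat_mem_supported hy (T := Set.univ) (by simp) ?_
      rintro _ ⟨a, h1, -, h2, rfl⟩ g -
      exact split_mem_negligible h h1 h2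
    · refine concat_mem_supported (single_mem_supported_singleton _ _) hx ?_
      rintro _ rfl g hg
      exact pair_mem_negligible h hk hg
  | @cons L B f h1 h _ ih =>
    obtain ⟨ε, hε, hx⟩ := ih fun C hC => hne C (List.mem_cons_of_mem _ hC)
    refine ⟨ε, hε, ?_⟩
    have e1 : basicCycle (L :: B :: f) - Finsupp.single (L :: B :: f) ε =
        concat (Finsupp.single [L] 1) (basicCycle (B :: f) - Finsupp.single (B :: f) ε) := by
      rw [basicCycle_cons h]
      simp [concat_single]
    rw [e1]
    refine concat_mem_supported (single_mem_supported_singleton _ _) hx ?_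
    rintro _ rfl g hg
    exact cons_mem_negligible h1 h hg

theorem symbolBoundary_cons_of_card_eq_one {L : Finset (Fin n)} (h : L.card = 1) (f : Symbol n) :
    symbolBoundary (L :: f) = concat (Finsupp.single [L] 1) (symbolBoundary f) := by
  rw [symbolBoundary, blockBoundary_of_card_eq_one h]
  simp [h]

theorem neg_one_pow_mul_self_eq_one (m : ℕ) : ((-1 : ℤ) ^ m) * (-1) ^ m = 1 := by
  rw [← mul_pow]
  simp

/-- Faces of `u` arise in three ways. Splitting the merged block gives `±g` and negligible terms;
splitting a follower before it lowers the key; splitting a later block leaves the merged block to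
stop the scan. Singletons have no faces. -/
theorem IsMatched.symbolBoundary_sub_mem_supported {g u : Symbol n} (h : IsMatched W k g u) :
    ∃ ε : ℤ, ε * ε = 1 ∧
      symbolBoundary u - Finsupp.single g ε ∈ Finsupp.supported ℤ ℤ (negligible W k g) := by
  induction h with
  | @merge L B C f h _ hB hC =>
    subst hC
    obtain ⟨δ, hδ, hy⟩ := blockBoundary_sub_mem_supported h hB
    refine ⟨δ, hδ, ?_⟩
    have e1 : symbolBoundary ((L ∪ B) :: f) - Finsupp.single (L :: B :: f) δ =
        concat (blockBoundary (L ∪ B) - Finsupp.single [L, B] δ) (Finsupp.single f 1) +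
        (-1 : ℤ) ^ ((L ∪ B).card - 1) • concat (Finsupp.single [L ∪ B] 1) (symbolBoundary f) := by
      rw [symbolBoundary, map_sub, LinearMap.sub_apply, concat_single, mul_one]
      simp only [List.cons_append, List.nil_append]
      abel
    rw [e1]
    refine Submodule.add_mem _ ?_ (Submodule.smul_mem _ _ ?_)
    · refine concat_mem_supported hy (single_mem_supported_singleton _ _) ?_
      rintro _ ⟨a, h1, -, h2, rfl⟩ _ rfl
      exact split_mem_negligible h h1 h2
    · refine concat_mem_supported (single_mem_supported_singleton _ _) (T := Set.univ) (by simp) ?_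
      rintro _ rfl g -
      exact Or.inl (.head (h.two_le_card_union hB))
  | @pair L B g u h hk _ ih =>
    obtain ⟨ε, hε, hx⟩ := ih
    have hs := neg_one_pow_mul_self_eq_one (B.card - 1)
    -- The extra factor is the Leibniz sign for passing `B`; the singleton `L` has dimension zero.
    refine ⟨(-1) ^ (B.card - 1) * ε, by rw [mul_mul_mul_comm, hs, hε, one_mul], ?_⟩
    have e1 : symbolBoundary (L :: B :: u) -
          Finsupp.single (L :: B :: g) ((-1) ^ (B.card - 1) * ε) =
        concat (Finsupp.single [L] 1) (concat (blockBoundary B) (Finsupp.single u 1)) +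
        concat (Finsupp.single [L, B] ((-1) ^ (B.card - 1)))
          (symbolBoundary u - Finsupp.single g ε) := by
      have e2 : (Finsupp.single [L, B] 1 : Chain n) =
          concat (Finsupp.single [L] 1) (Finsupp.single [B] 1) := by simp [concat_single]
      rw [symbolBoundary_cons_of_card_eq_one h.1, symbolBoundary, map_sub, concat_single,
        concat_smul_single [L, B], e2, concat_assoc, map_add, map_smul, add_sub_assoc]
      rfl
    rw [e1]
    refine Submodule.add_mem _ ?_ ?_
    · refine concat_mem_supported (single_mem_supported_singleton _ _)
        (concat_mem_supported (U := {x | ∃ a y, a ⊂ B ∧ x = a :: y})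
          (blockBoundary_mem_supported B) (single_mem_supported_singleton _ _) ?_) ?_
      · rintro _ ⟨a, h1, -, rfl⟩ _ rfl
        exact ⟨a, _, h1, rfl⟩
      · rintro _ rfl _ ⟨a, y, h1, rfl⟩
        refine Or.inr ?_
        rw [List.singleton_append, symbolKey_cons_lt, symbolKey_cons_lt]
        exact Or.inr ⟨rfl, Or.inl (blockKey_lt_of_ssubset h1)⟩
    · refine concat_mem_supported (single_mem_supported_singleton _ _) hx ?_
      rintro _ rfl g hg
      exact pair_mem_negligible h hk hg
  | @cons L B C g u h1 h _ _ ih =>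
    obtain ⟨ε, hε, hx⟩ := ih
    refine ⟨ε, hε, ?_⟩
    have e1 : symbolBoundary (L :: C :: u) - Finsupp.single (L :: B :: g) ε =
        concat (Finsupp.single [L] 1) (symbolBoundary (C :: u) - Finsupp.single (B :: g) ε) := by
      rw [symbolBoundary_cons_of_card_eq_one h1]
      simp [concat_single]
    rw [e1]
    refine concat_mem_supported (single_mem_supported_singleton _ _) hx ?_
    rintro _ rfl g hg
    exact cons_mem_negligible h1 h hg

/-! ### The chains `z(e)` lie in the weighted complex -/

/-- `h` consists of nonempty disjoint blocks of weight at most `k`, and has the same number of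
blocks and the same elements as `e`. -/
def IsRearrangement (W : Fin n → ℕ) (k : ℕ) (e h : Symbol n) : Prop :=
  (∀ B ∈ h, B.Nonempty ∧ blockWeight W B ≤ k) ∧ h.Pairwise Disjoint ∧
    (∀ i, (∃ B ∈ h, i ∈ B) ↔ ∃ B ∈ e, i ∈ B) ∧ h.length = e.length

/-- A proper subset misses some `x`, and `x` weighs at least as much as the leader's element, the
least of the union. Removing `x` therefore removes at least the weight of `L`. This is where
monotonicity of the weights enters. -/
theorem blockWeight_le_of_ssubset_union (hW : Monotone W) {L B a : Finset (Fin n)}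
    (h : Leads L B) (ha : a ⊂ L ∪ B) : blockWeight W a ≤ blockWeight W B := by
  obtain ⟨x, hx, hxa⟩ := Finset.exists_of_ssubset ha
  obtain ⟨l, rfl⟩ := Finset.card_eq_one.1 h.1
  have h1 : blockWeight W a + W x ≤ blockWeight W ({l} ∪ B) := by
    have hd : Disjoint a {x} := by simpa using hxa
    have : blockWeight W {x} = W x := by simp [blockWeight]
    rw [← this, ← blockWeight_union hd]
    exact Finset.sum_le_sum_of_subset (Finset.union_subset ha.1 (by simpa using hx))
  have h2 : W l ≤ W x := by
    refine hW ?_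
    rcases Finset.mem_union.1 hx with h' | h'
    · exact (Finset.mem_singleton.1 h').ge
    · exact (h.2 l (by simp) x h').le
  rw [blockWeight_union h.disjoint] at h1
  have : blockWeight W {l} = W l := by simp [blockWeight]
  omega

/-- The merged block `L ∪ B` is too heavy for the complex, but both pieces of any splitting are
proper subsets and weigh no more than `B`. Rearrangements replace cells in the induction because a
tail of `e` need not use all labels. -/
theorem basicCycle_mem_supported (hW : Monotone W) {e : Symbol n} (h : IsCrit W k e)
    (h1 : ∀ B ∈ e, B.Nonempty ∧ blockWeight W B ≤ k) (h2 : e.Pairwise Disjoint) :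
    basicCycle e ∈ Finsupp.supported ℤ ℤ {g | IsRearrangement W k e g} := by
  induction h with
  | nil => exact Finsupp.single_mem_supported _ _ ⟨h1, h2, fun _ => Iff.rfl, rfl⟩
  | single => exact Finsupp.single_mem_supported _ _ ⟨h1, h2, fun _ => Iff.rfl, rfl⟩
  | @pair L B f h hk _ ih =>
    simp only [List.pairwise_cons, List.mem_cons] at h2 h1
    obtain ⟨hL, hB, hf⟩ := h2
    rw [basicCycle_pair h]
    refine concat_mem_supported (blockBoundary_mem_supported _)
      (ih (fun C hC => h1 C (Or.inr (Or.inr hC))) hf) ?_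
    rintro _ ⟨a, ha, hane, rfl⟩ g ⟨g1, g2, g3, g4⟩
    have ha' : (L ∪ B) \ a ⊂ L ∪ B := Finset.sdiff_ssubset ha.1 hane
    have hne' : ((L ∪ B) \ a).Nonempty := Finset.sdiff_nonempty.2 ha.2
    have hBk := (h1 B (Or.inr (Or.inl rfl))).2
    have hd : ∀ C ∈ g, Disjoint (L ∪ B) C := by
      intro C hC
      rw [Finset.disjoint_right]
      intro i hi hi'
      obtain ⟨D, hD, hiD⟩ := (g3 i).1 ⟨C, hC, hi⟩
      rcases Finset.mem_union.1 hi' with h' | h'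
      · exact Finset.disjoint_left.1 (hL D (Or.inr hD)) h' hiD
      · exact Finset.disjoint_left.1 (hB D hD) h' hiD
    refine ⟨?_, ?_, ?_, ?_⟩
    · simp only [List.cons_append, List.nil_append, List.mem_cons]
      rintro C (rfl | rfl | hC)
      · exact ⟨hane, (blockWeight_le_of_ssubset_union hW h ha).trans hBk⟩
      · exact ⟨hne', (blockWeight_le_of_ssubset_union hW h ha').trans hBk⟩
      · exact g1 C hC
    · simp only [List.cons_append, List.nil_append, List.pairwise_cons, List.mem_cons]
      refine ⟨?_, fun C hC => (hd C hC).mono_left Finset.sdiff_subset, g2⟩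
      rintro C (rfl | hC)
      · exact Finset.disjoint_sdiff
      · exact (hd C hC).mono_left ha.1
    · intro i
      have h3 : (i ∈ a ∨ i ∈ (L ∪ B) \ a) ↔ (i ∈ L ∨ i ∈ B) := by
        rw [← Finset.mem_union, Finset.union_sdiff_of_subset ha.1, Finset.mem_union]
      simp only [List.cons_append, List.nil_append, List.exists_mem_cons_iff]
      rw [← or_assoc, h3, g3 i, or_assoc]
    · simp [g4]
  | @cons L B f hc h _ ih =>
    rw [List.pairwise_cons] at h2
    rw [basicCycle_cons h]
    refine concat_mem_supported (single_mem_supported_singleton _ _)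
      (ih (fun C hC => h1 C (List.mem_cons_of_mem _ hC)) h2.2) ?_
    rintro _ rfl g ⟨g1, g2, g3, g4⟩
    rw [List.singleton_append]
    refine ⟨?_, ?_, ?_, ?_⟩
    · intro C hC
      rcases List.mem_cons.1 hC with rfl | hC
      · exact h1 C (by simp)
      · exact g1 C hC
    · rw [List.pairwise_cons]
      refine ⟨fun C hC => ?_, g2⟩
      rw [Finset.disjoint_right]
      intro i hi hi'
      obtain ⟨D, hD, hiD⟩ := (g3 i).1 ⟨C, hC, hi⟩
      exact Finset.disjoint_left.1 (h2.1 D hD) hi' hiD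
    · intro i
      rw [List.exists_mem_cons_iff, g3 i, List.exists_mem_cons_iff (a := L)]
    · simpa using g4

theorem basicCycle_mem_chains (hW : Monotone W) {e : Symbol n} {d : ℕ} (h : IsCrit W k e)
    (he : e ∈ cells W k d) : basicCycle e ∈ chains W k d := by
  obtain ⟨⟨⟨h1, h2, h3⟩, h4⟩, h5⟩ := he
  refine Finsupp.supported_mono ?_
    (basicCycle_mem_supported hW h (fun B hB => ⟨h1 B hB, h4 B hB⟩) h2)
  rintro g ⟨g1, g2, g3, g4⟩
  exact ⟨⟨⟨fun B hB => (g1 B hB).1, g2, fun i => (g3 i).2 (h3 i)⟩, fun B hB => (g1 B hB).2⟩,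
    by rw [g4, h5]⟩

/-! ### The adapted basis -/

open Classical in
/-- A family of chains that is unitriangular with respect to the cells. -/
noncomputable def adaptedChain (W : Fin n → ℕ) (k : ℕ) (f : Symbol n) : Chain n :=
  if IsUpper W k f then Finsupp.single f 1
  else if IsCrit W k f then basicCycle f
  else if h : ∃ u, IsMatched W k f u then symbolBoundary h.choose else 0

open Classical in
/-- The rank with respect to which `adaptedChain` is unitriangular. -/
noncomputable def rank (W : Fin n → ℕ) (k : ℕ) (f : Symbol n) : WithBot (List ℕ) :=
  if IsUpper W k f then ⊥ else (symbolKey f : List ℕ)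

theorem adaptedChain_of_isUpper {f : Symbol n} (h : IsUpper W k f) :
    adaptedChain W k f = Finsupp.single f 1 :=
  if_pos h

theorem adaptedChain_of_isCrit {f : Symbol n} (h : IsCrit W k f) :
    adaptedChain W k f = basicCycle f := by
  rw [adaptedChain, if_neg h.not_isUpper, if_pos h]

theorem adaptedChain_of_isMatched {f u : Symbol n} (h : IsMatched W k f u) :
    adaptedChain W k f = symbolBoundary u := by
  have h' : ∃ u, IsMatched W k f u := ⟨u, h⟩
  rw [adaptedChain, if_neg h.not_isUpper, if_neg h.not_isCrit, dif_pos h',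
    h'.choose_spec.right_unique h]

theorem rank_lt {f g : Symbol n} (hf : ¬ IsUpper W k f) (hg : g ∈ negligible W k f) :
    rank W k g < rank W k f := by
  rw [rank, rank, if_neg hf]
  split_ifs with h
  · exact WithBot.bot_lt_coe _
  · exact WithBot.coe_lt_coe.2 (hg.resolve_left h)

/-- For a matched cell this holds because the merged pair is light, so that `u` is itself a cell,
one dimension higher. -/
theorem adaptedChain_mem_chains (hW : Monotone W) {d : ℕ} {f : Symbol n}
    (hf : f ∈ cells W k d) : adaptedChain W k f ∈ chains W k d := by
  rcases isCrit_or_isUpper_or_isMatched (W := W) (k := k) f hf.1.1.1 with h | h | ⟨u, h⟩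
  · rw [adaptedChain_of_isCrit h]
    exact basicCycle_mem_chains hW h hf
  · rw [adaptedChain_of_isUpper h]
    exact Finsupp.single_mem_supported _ _ hf
  · rw [adaptedChain_of_isMatched h, ← one_smul ℤ (symbolBoundary u), ← boundary_single]
    exact boundary_mem_chains W k d _ (Finsupp.single_mem_supported _ _ (h.mem_cells hf))

theorem adaptedChain_triangular {f : Symbol n} (hf : IsCell W k f) :
    ∃ ε : ℤ, ε * ε = 1 ∧ adaptedChain W k f - Finsupp.single f ε ∈
      Finsupp.supported ℤ ℤ {g | rank W k g < rank W k f} := by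
  rcases isCrit_or_isUpper_or_isMatched (W := W) (k := k) f hf.1.1 with h | h | ⟨u, h⟩
  · obtain ⟨ε, hε, hx⟩ := basicCycle_sub_mem_supported h hf.1.1
    rw [adaptedChain_of_isCrit h]
    exact ⟨ε, hε, Finsupp.supported_mono (fun g hg => rank_lt h.not_isUpper hg) hx⟩
  · rw [adaptedChain_of_isUpper h]
    exact ⟨1, rfl, by simp⟩
  · obtain ⟨ε, hε, hx⟩ := h.symbolBoundary_sub_mem_supported
    rw [adaptedChain_of_isMatched h]
    exact ⟨ε, hε, Finsupp.supported_mono (fun g hg => rank_lt h.not_isUpper hg) hx⟩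

theorem linearIndepOn_adaptedChain : LinearIndepOn ℤ (adaptedChain W k) {f | IsCell W k f} :=
  linearIndepOn_of_triangular fun _ hf => adaptedChain_triangular hf

theorem finite_cells (W : Fin n → ℕ) (k d : ℕ) : (cells W k d).Finite :=
  (List.finite_length_eq (Finset (Fin n)) (n - d)).subset fun f hf => by
    have := hf.2
    simp only [Set.mem_ofPred_eq]
    omega

theorem chains_le_span (hW : Monotone W) (k d : ℕ) :
    chains W k d ≤ Submodule.span ℤ (adaptedChain W k '' cells W k d) := by
  refine supported_le_span_of_triangular (finite_cells W k d) (r := rank W k) fun f hf => ?_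
  obtain ⟨ε, hε, hx⟩ := adaptedChain_triangular hf.1
  refine ⟨ε, hε, fun g hg => ⟨?_, hx hg⟩⟩
  exact (Submodule.sub_mem _ (adaptedChain_mem_chains hW hf)
    (Finsupp.single_mem_supported _ _ hf) :
      adaptedChain W k f - Finsupp.single f ε ∈ Finsupp.supported ℤ ℤ (cells W k d)) hg

/-! ### Upper cells have positive dimension -/

theorem sum_card_le {f : Symbol n} (h : f.Pairwise Disjoint) : (f.map Finset.card).sum ≤ n := by
  have hn : (f.flatMap fun B => B.toList).Nodup := by
    rw [List.nodup_flatMap]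
    refine ⟨fun B _ => B.nodup_toList, h.imp fun {a b} hab => ?_⟩
    intro x hx hx'
    exact Finset.disjoint_left.1 hab (Finset.mem_toList.1 hx) (Finset.mem_toList.1 hx')
  have := hn.length_le_card
  simpa [List.length_flatMap] using this

theorem length_le_sum_card {f : Symbol n} (h : ∀ B ∈ f, B.Nonempty) :
    f.length ≤ (f.map Finset.card).sum := by
  induction f with
  | nil => simp
  | cons B f ih =>
    have h1 := ih fun C hC => h C (List.mem_cons_of_mem _ hC)
    have h2 := (h B (by simp)).card_pos
    simp only [List.length_cons, List.map_cons, List.sum_cons]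
    omega

theorem IsUpper.length_lt_sum_card {f : Symbol n} (hu : IsUpper W k f)
    (h : ∀ B ∈ f, B.Nonempty) : f.length < (f.map Finset.card).sum := by
  induction hu with
  | @head B f h2 =>
    have h1 := length_le_sum_card fun C hC => h C (List.mem_cons_of_mem _ hC)
    simp only [List.length_cons, List.map_cons, List.sum_cons]
    omega
  | @pair L B f _ _ _ ih =>
    have h0 := ih fun C hC => h C (by simp [hC])
    have h1 := (h L (by simp)).card_pos
    have h2 := (h B (by simp)).card_pos
    simp only [List.length_cons, List.map_cons, List.sum_cons]
    omega
  | @cons L B f _ _ _ ih =>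
    have h0 := ih fun C hC => h C (List.mem_cons_of_mem _ hC)
    have h1 := (h L (by simp)).card_pos
    rw [List.length_cons, List.map_cons, List.sum_cons]
    omega

theorem IsUpper.length_lt {f : Symbol n} (hu : IsUpper W k f) (h : IsCell W k f) :
    f.length < n :=
  (hu.length_lt_sum_card h.1.1).trans_le (sum_card_le h.1.2.1)

theorem IsMatched.isCell {g u : Symbol n} (h : IsMatched W k g u) (hu : IsCell W k u)
    (hl : u.length < n) : IsCell W k g :=
  -- The degree is one less than the dimension of `u`; `hl` ensures that the subtraction does not
  -- truncate.
  (h.isFace.mem_cells (d := n - u.length - 1) ⟨hu, by omega⟩).1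

/-- Each such boundary is the adapted chain of the matched partner `g`, and `g` determines `u`. So
this is an injectively reindexed part of the adapted family; in other words, `∂` is injective on
upper chains. -/
theorem linearIndepOn_symbolBoundary :
    LinearIndepOn ℤ (symbolBoundary (n := n)) {u | IsCell W k u ∧ IsUpper W k u} := by
  classical
  have h : ∀ u : {u : Symbol n | IsCell W k u ∧ IsUpper W k u},
      ∃ g : {f : Symbol n | IsCell W k f}, IsMatched W k g.1 u.1 := by
    rintro ⟨u, hu, hu'⟩
    obtain ⟨g, hg⟩ := hu'.exists_isMatched hu.2
    exact ⟨⟨g, hg.isCell hu (hu'.length_lt hu)⟩, hg⟩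
  choose φ hφ using h
  have hinj : Function.Injective φ := fun u v huv =>
    Subtype.ext ((hφ u).right_unique (huv ▸ hφ v))
  have h2 := linearIndepOn_adaptedChain (W := W) (k := k)
  rw [LinearIndepOn] at h2 ⊢
  convert h2.comp φ hinj using 1
  ext1 u
  exact (adaptedChain_of_isMatched (hφ u)).symm

theorem IsMatched.mem_boundary_map {g u : Symbol n} {d : ℕ} (h : IsMatched W k g u)
    (hg : g ∈ cells W k d) : adaptedChain W k g ∈ (chains W k (d + 1)).map boundary := by
  rw [adaptedChain_of_isMatched h]
  exact ⟨Finsupp.single u 1, Finsupp.single_mem_supported _ _ (h.mem_cells hg),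
    by rw [boundary_single, one_smul]⟩

/-! ### Cycles modulo boundaries at the level of chains -/

/-- The symbols indexing the basis of the homology in degree `j`. -/
def criticalCells (W : Fin n → ℕ) (k j : ℕ) : Set (Symbol n) :=
  {e | e ∈ cells W k j ∧ IsCritical W k e}

/-- Every cycle is homologous to a combination of basic cycles. -/
theorem exists_sub_mem_boundary (hW : Monotone W) {j : ℕ} {c : Chain n} (hc : c ∈ chains W k j)
    (h0 : j = 0 ∨ boundary c = 0) :
    ∃ a ∈ Submodule.span ℤ (basicCycle '' criticalCells W k j),
      c - a ∈ (chains W k (j + 1)).map boundary := by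
  set M := Submodule.span ℤ (basicCycle '' criticalCells W k j) with hM
  set U : Set (Symbol n) := {u | u ∈ cells W k j ∧ IsUpper W k u} with hU
  -- The three summands come from the critical, matched and upper members of the adapted basis.
  have hle : chains W k j ≤
      M ⊔ (chains W k (j + 1)).map boundary ⊔ Finsupp.supported ℤ ℤ U := by
    refine (chains_le_span hW k j).trans (Submodule.span_le.2 ?_)
    rintro _ ⟨f, hf, rfl⟩
    rcases isCrit_or_isUpper_or_isMatched (W := W) (k := k) f hf.1.1.1 with h | h | ⟨u, h⟩
    · rw [adaptedChain_of_isCrit h]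
      exact Submodule.mem_sup_left (Submodule.mem_sup_left
        (Submodule.subset_span ⟨f, ⟨hf, (isCritical_iff_isCrit f).2 h⟩, rfl⟩))
    · rw [adaptedChain_of_isUpper h]
      exact Submodule.mem_sup_right (Finsupp.single_mem_supported _ _ ⟨hf, h⟩)
    · exact Submodule.mem_sup_left (Submodule.mem_sup_right (h.mem_boundary_map hf))
  obtain ⟨y, hy, u, hu, rfl⟩ := Submodule.mem_sup.1 (hle hc)
  obtain ⟨a, ha, b, hb, rfl⟩ := Submodule.mem_sup.1 hy
  have hMz : ∀ a ∈ M, boundary a = 0 := by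
    intro a ha
    have : M ≤ LinearMap.ker boundary := by
      rw [hM, Submodule.span_le]
      rintro _ ⟨e, ⟨-, he⟩, rfl⟩
      exact boundary_basicCycle ((isCritical_iff_isCrit e).1 he)
    exact this ha
  have hb0 : boundary b = 0 := by
    obtain ⟨y, -, rfl⟩ := hb
    exact boundary_boundary y
  -- In degree zero there are no upper cells. Otherwise the other two summands are cycles, so the
  -- upper part is one too, and `∂` is injective there.
  have hu0 : u = 0 := by
    rcases h0 with rfl | h0
    · have : U = ∅ := by
        refine Set.eq_empty_of_forall_notMem fun f hf => ?_
        have h1 := hf.2.length_lt hf.1.1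
        have h2 := hf.1.2
        omega
      rw [this] at hu
      simpa using hu
    · rw [map_add, map_add, hMz a ha, hb0, zero_add, zero_add] at h0
      have hs : U ⊆ {u | IsCell W k u ∧ IsUpper W k u} := fun f hf => ⟨hf.1.1, hf.2⟩
      exact linearIndepOn_iff.1 linearIndepOn_symbolBoundary u
        (Finsupp.supported_mono hs hu) h0
  refine ⟨a, ha, ?_⟩
  rwa [hu0, add_zero, add_sub_cancel_left]

/-- On the adapted basis, `∂` kills the critical and matched elements and sends an upper cell to the
adapted chain of its partner. -/
theorem boundary_map_le_span (hW : Monotone W) (j : ℕ) :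
    (chains W k (j + 1)).map boundary ≤ Submodule.span ℤ
      (adaptedChain W k '' {f | IsCell W k f ∧ ∃ u, IsMatched W k f u}) := by
  refine (Submodule.map_mono (chains_le_span hW k (j + 1))).trans ?_
  rw [Submodule.map_span, Submodule.span_le]
  rintro _ ⟨_, ⟨f, hf, rfl⟩, rfl⟩
  rcases isCrit_or_isUpper_or_isMatched (W := W) (k := k) f hf.1.1.1 with h | h | ⟨u, h⟩
  · rw [adaptedChain_of_isCrit h, boundary_basicCycle h]
    exact Submodule.zero_mem _
  · obtain ⟨g, hg⟩ := h.exists_isMatched hf.1.2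
    rw [adaptedChain_of_isUpper h, boundary_single, one_smul, ← adaptedChain_of_isMatched hg]
    exact Submodule.subset_span ⟨g, ⟨hg.isCell hf.1 (h.length_lt hf.1), f, hg⟩, rfl⟩
  · rw [adaptedChain_of_isMatched h, boundary_symbolBoundary]
    exact Submodule.zero_mem _

/-- No nontrivial combination of basic cycles is a boundary. -/
theorem disjoint_span_basicCycle (hW : Monotone W) (j : ℕ) :
    Disjoint (Submodule.span ℤ (basicCycle '' criticalCells W k j))
      ((chains W k (j + 1)).map boundary) := by
  refine Disjoint.mono_right (boundary_map_le_span hW j) ?_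
  have e1 : basicCycle '' criticalCells W k j = adaptedChain W k '' criticalCells W k j :=
    Set.image_congr fun f hf => (adaptedChain_of_isCrit ((isCritical_iff_isCrit f).1 hf.2)).symm
  rw [e1]
  have h := linearIndepOn_adaptedChain (W := W) (k := k)
  -- Disjoint parts of an independent family span submodules meeting only in zero; no cell is both
  -- critical and matched.
  have h2 := h.linearIndependent.disjoint_span_image
    (s := {f | f.1 ∈ criticalCells W k j}) (t := {f | ∃ u, IsMatched W k f.1 u}) (by
      rw [Set.disjoint_left]
      rintro f hf ⟨u, hu⟩
      exact hu.not_isCrit ((isCritical_iff_isCrit f.1).1 hf.2))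
  refine h2.mono (Submodule.span_mono ?_) (Submodule.span_mono ?_)
  · rintro _ ⟨f, hf, rfl⟩
    exact ⟨⟨f, hf.1.1⟩, hf, rfl⟩
  · rintro _ ⟨f, hf, rfl⟩
    exact ⟨⟨f, hf.1⟩, hf.2, rfl⟩

theorem linearIndepOn_basicCycle (W : Fin n → ℕ) (k j : ℕ) :
    LinearIndepOn ℤ basicCycle (criticalCells W k j) := by
  refine LinearIndepOn.congr (v := adaptedChain W k)
    (linearIndepOn_adaptedChain.mono fun f hf => hf.1.1) fun f hf => ?_
  exact adaptedChain_of_isCrit ((isCritical_iff_isCrit f).1 hf.2)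

/-! ### Passage to the categorical homology -/

section homology

variable {j : ℕ}

/-- `cycleToChain` as a linear map. -/
noncomputable def cyclesToChain (W : Fin n → ℕ) (k j : ℕ) :
    (cellularComplex W k).cycles j →ₗ[ℤ] Chain n :=
  (chains W k j).subtype ∘ₗ ((cellularComplex W k).iCycles j).hom

theorem cellularComplex_d (c : chains W k (j + 1)) :
    ((cellularComplex W k).d (j + 1) j).hom c =
      (⟨boundary c.1, boundary_mem_chains W k j c.1 c.2⟩ : chains W k j) := by
  have h : (cellularComplex W k).d (j + 1) j =
      ModuleCat.ofHom (boundary.restrict (boundary_mem_chains W k j)) :=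
    ChainComplex.of_d (fun d => ModuleCat.of ℤ (chains W k d))
      (fun d => ModuleCat.ofHom (boundary.restrict (boundary_mem_chains W k d))) j
  rw [h]
  rfl

theorem cyclesToChain_injective : Function.Injective (cyclesToChain W k j) := by
  have h := (ModuleCat.mono_iff_injective ((cellularComplex W k).iCycles j)).1 inferInstance
  exact Subtype.val_injective.comp h

theorem cyclesToChain_mem (z : (cellularComplex W k).cycles j) :
    cyclesToChain W k j z ∈ chains W k j :=
  (show chains W k j from ((cellularComplex W k).iCycles j).hom z).2

theorem boundary_cyclesToChain (z : (cellularComplex W k).cycles (j + 1)) :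
    boundary (cyclesToChain W k (j + 1) z) = 0 := by
  have h := (cellularComplex W k).iCycles_d (j + 1) j
  have h2 := LinearMap.congr_fun (ModuleCat.hom_ext_iff.1 h) z
  have h3 := cellularComplex_d (show chains W k (j + 1) from
    ((cellularComplex W k).iCycles (j + 1)).hom z)
  exact congrArg Subtype.val (h3.symm.trans h2)

theorem exists_cyclesToChain_eq {c : Chain n} (hc : c ∈ chains W k j) (h0 : boundary c = 0) :
    ∃ z, cyclesToChain W k j z = c := by
  let K := cellularComplex W k
  -- The chain `c` is encoded as a morphism out of `ℤ`, so that the universal property of cycles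
  -- applies; the lift is then evaluated at `1`.
  let φ : ModuleCat.of ℤ ℤ ⟶ K.X j :=
    ModuleCat.ofHom (LinearMap.toSpanSingleton ℤ (chains W k j) ⟨c, hc⟩)
  have hφ : φ ≫ K.d j ((ComplexShape.down ℕ).next j) = 0 := by
    cases j with
    | zero =>
      rw [K.shape _ _ (by simp), Limits.comp_zero]
    | succ j =>
      rw [ChainComplex.next_nat_succ]
      refine ModuleCat.hom_ext (LinearMap.ext_ring ?_)
      have h1 : φ.hom (1 : ℤ) = (⟨c, hc⟩ : chains W k (j + 1)) := one_smul ℤ _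
      have h2 := cellularComplex_d (⟨c, hc⟩ : chains W k (j + 1))
      rw [ModuleCat.hom_comp, LinearMap.comp_apply, h1]
      exact h2.trans (Subtype.ext h0)
  refine ⟨(K.liftCycles φ _ rfl hφ).hom (1 : ℤ), ?_⟩
  have h := K.liftCycles_i φ _ rfl hφ
  have h2 := LinearMap.congr_fun (ModuleCat.hom_ext_iff.1 h) (1 : ℤ)
  exact (congrArg Subtype.val h2).trans (one_smul ℤ c)

/-- Homology is the cokernel of the map from chains of degree `j + 1` to cycles, so the kernel of
the projection is the image of that map; injectivity of the inclusion of cycles lets this be tested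
on chains. -/
theorem homologyπ_eq_zero_iff (z : (cellularComplex W k).cycles j) :
    ((cellularComplex W k).homologyπ j).hom z = 0 ↔
      cyclesToChain W k j z ∈ (chains W k (j + 1)).map boundary := by
  let K := cellularComplex W k
  let T := ShortComplex.mk (K.toCycles (j + 1) j) (K.homologyπ j) (by simp)
  have hT : T.Exact := T.exact_of_g_is_cokernel
    (K.homologyIsCokernel (j + 1) j (ChainComplex.prev ℕ j))
  have hi : ∀ y : chains W k (j + 1),
      cyclesToChain W k j ((K.toCycles (j + 1) j).hom y) = boundary y.1 := by
    intro y
    have h := LinearMap.congr_fun (ModuleCat.hom_ext_iff.1 (K.toCycles_i (j + 1) j)) y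
    exact congrArg Subtype.val (h.trans (cellularComplex_d y))
  constructor
  · intro hz
    obtain ⟨y, hy⟩ := (ShortComplex.moduleCat_exact_iff T).1 hT z hz
    refine ⟨(show chains W k (j + 1) from y).1, (show chains W k (j + 1) from y).2, ?_⟩
    rw [← hi]
    exact congrArg _ hy
  · rintro ⟨y, hy, h⟩
    have hz : (K.toCycles (j + 1) j).hom (show chains W k (j + 1) from ⟨y, hy⟩) = z :=
      cyclesToChain_injective ((hi ⟨y, hy⟩).trans h)
    rw [← hz]
    exact LinearMap.congr_fun (ModuleCat.hom_ext_iff.1 T.zero) _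

end homology

end WeightedPermutohedron

/-! ### The basis of the homology -/

open WeightedPermutohedron in
theorem exists_homology_basis (n k : ℕ) (W : Fin n → ℕ) (hW : Monotone W) (j : ℕ) :
    ∃ b : Module.Basis {e : Symbol n // e ∈ cells W k j ∧ IsCritical W k e}
        ℤ ((cellularComplex W k).homology j),
      ∀ e, ∃ z : (cellularComplex W k).cycles j,
        cycleToChain z = basicCycle e.1 ∧
        b e = (cellularComplex W k).homologyπ j z := by
  have hz : ∀ e : {e : Symbol n // e ∈ cells W k j ∧ IsCritical W k e},
      ∃ z, cyclesToChain W k j z = basicCycle e.1 := fun e =>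
    have he := (isCritical_iff_isCrit e.1).1 e.2.2
    exists_cyclesToChain_eq (basicCycle_mem_chains hW he e.2.1) (boundary_basicCycle he)
  choose z hz using hz
  let π := ((cellularComplex W k).homologyπ j).hom
  have hπ : Function.Surjective π :=
    (ModuleCat.epi_iff_surjective ((cellularComplex W k).homologyπ j)).1 inferInstance
  have hspan : ∀ a ∈ Submodule.span ℤ (basicCycle '' criticalCells W k j),
      ∃ y ∈ Submodule.span ℤ (Set.range z), cyclesToChain W k j y = a := by
    intro a ha
    have e1 : basicCycle '' criticalCells W k j = cyclesToChain W k j '' Set.range z := by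
      rw [← Set.range_comp, Set.image_eq_range]
      exact congrArg Set.range (funext fun e => (hz e).symm)
    rw [e1, ← Submodule.map_span] at ha
    exact ha
  have hli : LinearIndependent ℤ fun e => π (z e) := by
    rw [linearIndependent_iff]
    intro l hl
    have h1 : Finsupp.linearCombination ℤ (fun e => π (z e)) l =
        π (Finsupp.linearCombination ℤ z l) := by
      rw [Finsupp.apply_linearCombination]
      rfl
    rw [h1, homologyπ_eq_zero_iff, Finsupp.apply_linearCombination] at hl
    have h2 : (cyclesToChain W k j ∘ z) =
        fun e : {e : Symbol n // e ∈ cells W k j ∧ IsCritical W k e} => basicCycle e.1 :=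
      funext hz
    rw [h2] at hl
    -- A relation between the classes makes a combination of the `z(e)` a boundary, hence zero as a
    -- chain.
    have h3 := Submodule.disjoint_def.1 (disjoint_span_basicCycle (k := k) hW j) _ (by
      rw [Finsupp.linearCombination_apply]
      exact Submodule.sum_mem _ fun e _ => Submodule.smul_mem _ _
        (Submodule.subset_span ⟨e.1, e.2, rfl⟩)) hl
    exact linearIndependent_iff.1 (linearIndepOn_basicCycle W k j).linearIndependent l h3
  have htop : ⊤ ≤ Submodule.span ℤ (Set.range fun e => π (z e)) := by
    rintro x -
    obtain ⟨c, rfl⟩ := hπ x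
    obtain ⟨a, ha, h⟩ := exists_sub_mem_boundary hW (cyclesToChain_mem c) (by
      cases j with
      | zero => exact Or.inl rfl
      | succ j => exact Or.inr (boundary_cyclesToChain c))
    obtain ⟨y, hy, rfl⟩ := hspan a ha
    rw [← map_sub, ← homologyπ_eq_zero_iff, map_sub, sub_eq_zero] at h
    have h4 : π c = π y := h
    have h5 : (Set.range fun e => π (z e)) = π '' Set.range z := Set.range_comp π z
    rw [h4, h5, ← Submodule.map_span]
    exact ⟨y, hy, rfl⟩
  refine ⟨Module.Basis.mk hli htop, fun e => ⟨z e, hz e, ?_⟩⟩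
  rw [Module.Basis.mk_apply]

theorem mainTheorem4 (n k : ℕ) (W : Fin n → ℕ) (hW : Monotone W) (j : ℕ) :
    Module.Free ℤ ((WeightedPermutohedron.cellularComplex W k).homology j) ∧
    ∃ b : Module.Basis
        {e : WeightedPermutohedron.Symbol n //
          e ∈ WeightedPermutohedron.cells W k j ∧ WeightedPermutohedron.IsCritical W k e}
        ℤ ((WeightedPermutohedron.cellularComplex W k).homology j),
      ∀ e, ∃ z : (WeightedPermutohedron.cellularComplex W k).cycles j,
        WeightedPermutohedron.cycleToChain z = WeightedPermutohedron.basicCycle e.1 ∧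
        b e = (WeightedPermutohedron.cellularComplex W k).homologyπ j z := by
  obtain ⟨b, hb⟩ := exists_homology_basis n k W hW j
  exact ⟨Module.Free.of_basis b, b, hb⟩
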